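/- In the infinite server problem on $(M,s)$, where $M$ is a metric space and $s\in M$, infinitely many servers start at the source $s$ and a finite sequence of requests $\sigma_1,\dots,\sigma_m\in M$ is revealed one by one; each request must be served immediately by having a server located at it, and the cost is the total distance travelled by all servers. A deterministic online algorithm $\mathrm{ALG}$ is $\rho$-competitive ($\rho\ge 1$) if there is a constant $c$ such that $\mathrm{ALG}(\sigma)\le\rho\,\mathrm{OPT}(\sigma)+c$ for all finite request sequences $\sigma$, where $\mathrm{OPT}(\sigma)$ is the optimal offline cost. The competitive ratio of the problem on $(M,s)$ is the infimum of all $\rho$ such that some deterministic online algorithm is $\rho$-competitive. An edge-weighted rooted tree (possibly with infinitely many nodes) with positive edge weights is regarded as the metric space of its nodes, the distance of two nodes being the sum of the edge weights along their connecting path. Its depth is the maximal number of edges from the root to a leaf. Theorem. There is an absolute constant $C$ such that, for every integer $d\ge 1$ and every edge-weighted rooted tree $T$ of depth $d$, the competitive ratio of the infinite server problem on $T$ with the source at the root is at most $C\cdot 2^d\cdot d$. -/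

import Mathlib

open scoped NNReal ENNReal

universe u

noncomputable section

/-! ### Edge-weighted rooted trees and their metric -/

/-- A rooted tree on the (possibly infinite) node set `V` with positive edge weights.
The values of `weight` outside the edge set play no role. -/
structure WeightedTree (V : Type u) where
  graph : SimpleGraph V
  isTree : graph.IsTree
  weight : Sym2 V → ℝ
  weight_pos : ∀ e ∈ graph.edgeSet, 0 < weight e
  root : V

namespace WeightedTree

variable {V : Type u}

/-- The sum of the edge weights along a walk. -/
def walkWeight (T : WeightedTree V) {u v : V} (p : T.graph.Walk u v) : ℝ :=
  (p.edges.map T.weight).sum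

/-- The path connecting two nodes. -/
def path (T : WeightedTree V) (u v : V) : T.graph.Walk u v :=
  (T.isTree.existsUnique_path u v).choose

theorem path_isPath (T : WeightedTree V) (u v : V) : (T.path u v).IsPath :=
  (T.isTree.existsUnique_path u v).choose_spec.1

theorem eq_path (T : WeightedTree V) {u v : V} (p : T.graph.Walk u v) (hp : p.IsPath) :
    p = T.path u v :=
  (T.isTree.existsUnique_path u v).choose_spec.2 p hp

/-- The distance of two nodes: the sum of the edge weights along their connecting path. -/
def nodeDist (T : WeightedTree V) (u v : V) : ℝ :=
  T.walkWeight (T.path u v)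

theorem walkWeight_nonneg (T : WeightedTree V) {u v : V} (p : T.graph.Walk u v) :
    0 ≤ T.walkWeight p := by
  apply List.sum_nonneg
  intro x hx
  obtain ⟨e, he, rfl⟩ := List.mem_map.1 hx
  exact (T.weight_pos e (p.edges_subset_edgeSet he)).le

theorem nodeDist_le_walkWeight (T : WeightedTree V) {u v : V} (p : T.graph.Walk u v) :
    T.nodeDist u v ≤ T.walkWeight p := by
  classical
  have h : T.path u v = p.bypass := (T.eq_path _ p.bypass_isPath).symm
  rw [nodeDist, h, walkWeight, walkWeight]
  obtain ⟨l, hl⟩ := (List.subperm_of_subset p.bypass_isPath.isTrail.edges_nodup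
    p.edges_bypass_subset_edges)
  rw [← (hl.1.map T.weight).sum_eq]
  apply (hl.2.map T.weight).sum_le_sum
  intro x hx
  obtain ⟨e, he, rfl⟩ := List.mem_map.1 hx
  exact (T.weight_pos e (p.edges_subset_edgeSet he)).le

theorem nodeDist_self (T : WeightedTree V) (u : V) : T.nodeDist u u = 0 := by
  have h : T.path u u = SimpleGraph.Walk.nil := (T.eq_path _ SimpleGraph.Walk.IsPath.nil).symm
  simp [nodeDist, h, walkWeight]

theorem nodeDist_comm (T : WeightedTree V) (u v : V) : T.nodeDist u v = T.nodeDist v u := by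
  have h : T.path v u = (T.path u v).reverse := (T.eq_path _ (T.path_isPath u v).reverse).symm
  simp [nodeDist, h, walkWeight]

theorem nodeDist_triangle (T : WeightedTree V) (u v w : V) :
    T.nodeDist u w ≤ T.nodeDist u v + T.nodeDist v w := by
  have h := T.nodeDist_le_walkWeight ((T.path u v).append (T.path v w))
  simpa [walkWeight, nodeDist] using h

theorem eq_of_nodeDist_eq_zero (T : WeightedTree V) {u v : V} (h : T.nodeDist u v = 0) :
    u = v := by
  rw [nodeDist] at h
  generalize T.path u v = p at h
  cases p with
  | nil => rfl
  | cons hadj q =>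
    exfalso
    have h1 := T.weight_pos _ (T.graph.mem_edgeSet.2 hadj)
    have h2 := T.walkWeight_nonneg q
    simp only [walkWeight, SimpleGraph.Walk.edges_cons, List.map_cons, List.sum_cons] at h h2
    linarith

/-- The nodes of the tree, as the points of a metric space. -/
def Node (_T : WeightedTree V) : Type u := V

instance (T : WeightedTree V) : MetricSpace T.Node where
  dist := T.nodeDist
  dist_self := T.nodeDist_self
  dist_comm := T.nodeDist_comm
  dist_triangle := T.nodeDist_triangle
  eq_of_dist_eq_zero := T.eq_of_nodeDist_eq_zero

/-- The root, as a point of the metric space. -/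
def source (T : WeightedTree V) : T.Node := T.root

/-- The depth of the tree: the supremum over the nodes of the number of edges on the path from
the root. When it is finite, it is attained at a leaf. -/
def depth (T : WeightedTree V) : ℕ∞ :=
  ⨆ v : V, ((T.path T.root v).length : ℕ∞)

end WeightedTree

/-! ### The infinite server problem -/

namespace InfiniteServer

/-- The positions of the servers, which are indexed by `ℕ`. -/
abbrev Config (M : Type u) : Type u := ℕ → M

section

variable {M : Type u} [MetricSpace M]

/-- The total distance travelled by the servers when they move from one configuration to
another. -/
def moveCost (x y : Config M) : ℝ≥0∞ := ∑' i, edist (x i) (y i)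

/-- An offline schedule for the finite request sequence `σ`: `c j` is the configuration after
the first `j` requests, all servers start at `s`, and when the request `σ[j]` has been served,
some server is located at it. -/
def IsSchedule (s : M) (σ : List M) (c : ℕ → Config M) : Prop :=
  (∀ i, c 0 i = s) ∧ ∀ (j : ℕ) (hj : j < σ.length), ∃ i, c (j + 1) i = σ[j]

/-- The total distance travelled by the servers during the first `m` requests. -/
def scheduleCost (m : ℕ) (c : ℕ → Config M) : ℝ≥0∞ :=
  ∑ j ∈ Finset.range m, moveCost (c j) (c (j + 1))

/-- The optimal offline cost for serving `σ`. -/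
def opt (s : M) (σ : List M) : ℝ≥0∞ :=
  ⨅ (c : ℕ → Config M) (_ : IsSchedule s σ c), scheduleCost σ.length c

end

/-- A deterministic online algorithm for the infinite server problem on `(M, s)`: the
configuration after a request sequence depends only on the requests revealed so far, and the
last request of the sequence is covered by a server. -/
structure OnlineAlgorithm (M : Type u) (s : M) where
  config : List M → Config M
  config_nil : ∀ i, config [] i = s
  serves : ∀ (σ : List M) (r : M), ∃ i, config (σ ++ [r]) i = r

variable {M : Type u} [MetricSpace M] {s : M}

/-- The cost of an online algorithm on the request sequence `σ`. -/
def OnlineAlgorithm.cost (A : OnlineAlgorithm M s) (σ : List M) : ℝ≥0∞ :=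
  scheduleCost σ.length fun j => A.config (σ.take j)

/-- `ρ`-competitiveness, for `ρ ≥ 1`, with an additive constant independent of the requests. -/
def OnlineAlgorithm.IsCompetitive (A : OnlineAlgorithm M s) (ρ : ℝ≥0) : Prop :=
  1 ≤ ρ ∧ ∃ c : ℝ≥0, ∀ σ : List M, A.cost σ ≤ ρ * opt s σ + c

/-- The competitive ratio of an online algorithm (`∞` if it is not competitive). -/
def OnlineAlgorithm.competitiveRatio (A : OnlineAlgorithm M s) : ℝ≥0∞ :=
  ⨅ (ρ : ℝ≥0) (_ : A.IsCompetitive ρ), (ρ : ℝ≥0∞)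

variable (M s) in
/-- The competitive ratio of the infinite server problem on `(M, s)`: the infimum of the
competitive ratios of the deterministic online algorithms. -/
def competitiveRatio : ℝ≥0∞ :=
  ⨅ A : OnlineAlgorithm M s, A.competitiveRatio

end InfiniteServer

end

/-!
The online algorithm maintains, for every node `v` other than the root, a fractional mass `x v` in
the subtree `T_v` of `v`, subject to `x v ≥ ∑ x c` over the children `c` of `v`; the root is an
unlimited supply. Write `w v` for the weight of the edge above `v`, `l v ≤ d` for the level of `v`,
and `p` for the indicator of the branch of the request `r` (the nodes from `r` up to, but without,
the root).

*Fractional step.* On the request `r` the mass moves to the minimizer `y` of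
`∑ w v (y v - x v)² / (x v + 2 p v)` under the constraint that a unit of mass is at `r`: the mass
flows to `r` as a current in a network whose conductances are the masses divided by the edge
weights. Truncation shows that no mass changes by more than one unit
(`exists_isMinOn_energy`). Let `h v` be the number of servers of an offline schedule in `T_v`, and
`b = 6d + 4`. The potential is `∑ w v (2 l v x v - b P (x v, h v))`, where `P` (`value`) is the
integral of `min 1 (h / (t + 1))` over `t ≤ min x (b h)`. Its derivative in the direction of the
step is compared with the direction `slope`, which the minimizer can be perturbed along
(`slope_le_childSum`): where `T_v` has mass below `b h v`, this is because
`∑ min (x c) (h c) ≤ min (x v) (h v)`; where `T_v` has mass at least `b h v`, the values of the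
children are negligible, and the weight `2 l v` increases with the level. The variational
inequality (`sum_mul_le_zero_of_isMin`) then bounds the mass moved downwards by the decrease of the
potential (`exists_fractional_step`). The cutoff at `b h` makes the potential Lipschitz in `h`
(`abs_value_sub_le`), so the moves of the schedule raise it by `O(b²)` times their cost.

*Rounding.* The number of servers in `T_v` is changed only when it leaves the window between
`2dx/(d + l)` and `2dx/(d + l - 1)`. The windows of a node and of its children share an endpoint,
whence the numbers of servers again satisfy the constraints of a configuration, and the hysteresis
costs a factor `O(d)` only (`abs_roundServers_sub_le`). `exists_transport` realizes the new numbers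
by server movements of the right cost.

Altogether the algorithm is `16 d (6d + 4)²`-competitive (`cost_treeAlgorithm_le`), without an
additive constant, and `d² ≤ 2 · 2 ^ d`.
-/

noncomputable section

open scoped Classical

/-! ### Parents, levels and branches in a weighted tree -/

namespace WeightedTree

variable {V : Type u} (T : WeightedTree V)

/-- The number of edges on the path from the root to `v`. -/
def level (v : V) : ℕ := (T.path T.root v).length

/-- The parent of `v`; the parent of the root is the root itself. -/
def parent (v : V) : V := (T.path T.root v).penultimate

/-- The weight of the edge from `v` to its parent (no meaning at the root). -/
def edgeWeight (v : V) : ℝ := T.weight s(T.parent v, v)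

/-- The nodes on the path from the root to `v`, without the root. Hence `v` lies in the
subtree hanging at `a ≠ root` if and only if `a ∈ T.branch v`. -/
def branch (v : V) : Finset V := (T.path T.root v).support.toFinset.erase T.root

theorem path_root_root : T.path T.root T.root = SimpleGraph.Walk.nil :=
  (T.eq_path _ SimpleGraph.Walk.IsPath.nil).symm

@[simp] theorem level_root : T.level T.root = 0 := by
  simp [level, path_root_root]

@[simp] theorem branch_root : T.branch T.root = ∅ := by
  ext a
  simp [branch, path_root_root]

theorem root_notMem_branch (v : V) : T.root ∉ T.branch v := by
  simp [branch]

theorem ne_root_of_mem_branch {a v : V} (h : a ∈ T.branch v) : a ≠ T.root :=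
  Finset.ne_of_mem_erase h

variable {T}

theorem path_not_nil {v : V} (hv : v ≠ T.root) : ¬ (T.path T.root v).Nil :=
  SimpleGraph.Walk.not_nil_of_ne hv.symm

theorem adj_parent {v : V} (hv : v ≠ T.root) : T.graph.Adj (T.parent v) v :=
  SimpleGraph.Walk.adj_penultimate (path_not_nil hv)

theorem path_parent {v : V} :
    T.path T.root (T.parent v) = (T.path T.root v).dropLast :=
  (T.eq_path _ (T.path_isPath _ _).dropLast).symm

theorem level_parent {v : V} (hv : v ≠ T.root) : T.level v = T.level (T.parent v) + 1 := by
  rw [level, level, path_parent]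
  exact (SimpleGraph.Walk.length_dropLast_add_one (path_not_nil hv)).symm

theorem branch_eq_insert {v : V} (hv : v ≠ T.root) :
    T.branch v = insert v (T.branch (T.parent v)) := by
  ext a
  have h := SimpleGraph.Walk.support_dropLast_concat (path_not_nil hv)
  simp only [branch, path_parent, Finset.mem_insert, Finset.mem_erase, List.mem_toFinset]
  conv_lhs => rw [← h]
  simp only [List.mem_append, List.mem_singleton]
  constructor
  · rintro ⟨h1, h2 | h2⟩
    · exact Or.inr ⟨h1, h2⟩
    · exact Or.inl h2
  · rintro (rfl | h2)
    · exact ⟨hv, Or.inr rfl⟩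
    · exact ⟨h2.1, Or.inl h2.2⟩

theorem edgeWeight_pos {v : V} (hv : v ≠ T.root) : 0 < T.edgeWeight v :=
  T.weight_pos _ (T.graph.mem_edgeSet.2 (adj_parent hv))

/-- Of two adjacent nodes, one is the parent of the other. -/
theorem adj_cases {u v : V} (h : T.graph.Adj u v) :
    (v ≠ T.root ∧ T.parent v = u) ∨ (u ≠ T.root ∧ T.parent u = v) := by
  by_cases hm : v ∈ (T.path T.root u).support
  · right
    have hp := T.path_isPath T.root u
    have hu : u ∉ ((T.path T.root u).takeUntil v hm).support :=
      SimpleGraph.Walk.endpoint_notMem_support_takeUntil hp hm h.ne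
    have hc := T.eq_path _ ((hp.takeUntil hm).concat hu h.symm)
    refine ⟨?_, ?_⟩
    · rintro rfl
      rw [path_root_root] at hm
      simp at hm
      exact h.ne hm.symm
    · rw [parent, ← hc, SimpleGraph.Walk.penultimate_concat]
  · left
    have hc := T.eq_path _ ((T.path_isPath T.root u).concat hm h)
    refine ⟨?_, ?_⟩
    · rintro rfl
      exact hm (SimpleGraph.Walk.start_mem_support _)
    · rw [parent, ← hc, SimpleGraph.Walk.penultimate_concat]

theorem nodeDist_parent_le {v : V} (hv : v ≠ T.root) :
    T.nodeDist (T.parent v) v ≤ T.edgeWeight v := by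
  have h := T.nodeDist_le_walkWeight (SimpleGraph.Walk.cons (adj_parent hv) .nil)
  simpa [walkWeight, edgeWeight] using h

theorem level_le_of_mem_branch {a v : V} (h : a ∈ T.branch v) : T.level a ≤ T.level v := by
  induction hn : T.level v generalizing v with
  | zero =>
    by_cases hv : v = T.root
    · subst hv; simp at h
    · have := level_parent hv; omega
  | succ n ih =>
    by_cases hv : v = T.root
    · subst hv; simp at h
    · have h1 := level_parent hv
      rw [branch_eq_insert hv, Finset.mem_insert] at h
      rcases h with rfl | h
      · omega
      · have := ih h (by omega); omega

theorem self_mem_branch {v : V} (hv : v ≠ T.root) : v ∈ T.branch v := by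
  rw [branch_eq_insert hv]; exact Finset.mem_insert_self _ _

theorem notMem_branch_parent {v : V} (hv : v ≠ T.root) : v ∉ T.branch (T.parent v) := by
  intro h
  have := level_le_of_mem_branch h
  have := level_parent hv
  omega

/-- Induction along the tree, from the root downwards. -/
theorem parent_induction {motive : V → Prop} (root : motive T.root)
    (step : ∀ v, v ≠ T.root → motive (T.parent v) → motive v) (v : V) : motive v := by
  induction hn : T.level v generalizing v with
  | zero =>
    by_cases hv : v = T.root
    · subst hv; exact root
    · have := level_parent hv; omega
  | succ n ih =>
    by_cases hv : v = T.root
    · subst hv; exact root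
    · have h1 := level_parent hv
      exact step v hv (ih _ (by omega))

theorem parent_mem_branch {a v : V} (h : a ∈ T.branch v) (ha : T.parent a ≠ T.root) :
    T.parent a ∈ T.branch v := by
  induction v using parent_induction (T := T) with
  | root => simp at h
  | step v hv ih =>
    rw [branch_eq_insert hv, Finset.mem_insert] at h ⊢
    rcases h with rfl | h
    · exact Or.inr (self_mem_branch ha)
    · exact Or.inr (ih h)

/-- A branch contains at most one child of any node. -/
theorem eq_of_mem_branch_of_parent_eq {a b v : V} (ha : a ∈ T.branch v) (hb : b ∈ T.branch v)
    (h : T.parent a = T.parent b) : a = b := by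
  have ha0 := T.ne_root_of_mem_branch ha
  have hb0 := T.ne_root_of_mem_branch hb
  have hl : T.level a = T.level b := by rw [level_parent ha0, level_parent hb0, h]
  induction v using parent_induction (T := T) with
  | root => simp at ha
  | step v hv ih =>
    rw [branch_eq_insert hv, Finset.mem_insert] at ha hb
    have hv1 := level_parent hv
    rcases ha with rfl | ha
    · rcases hb with rfl | hb
      · rfl
      · have := level_le_of_mem_branch hb; omega
    · rcases hb with rfl | hb
      · have := level_le_of_mem_branch ha; omega
      · exact ih ha hb

theorem parent_ne_of_mem_branch_self {a v : V} (ha : a ∈ T.branch v) : T.parent a ≠ v := by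
  intro h
  have h1 := level_le_of_mem_branch ha
  have h2 := level_parent (T.ne_root_of_mem_branch ha)
  rw [h] at h2; omega

/-- Below a proper ancestor `a` of `v`, the branch of `v` continues with a child of `a`. -/
theorem exists_child_mem_branch {a v : V} (h : a ∈ T.branch v) (hne : v ≠ a) :
    ∃ c ∈ T.branch v, T.parent c = a := by
  induction v using parent_induction (T := T) with
  | root => simp at h
  | step v hv ih =>
    have h' := h
    rw [branch_eq_insert hv, Finset.mem_insert] at h
    rcases h with rfl | h
    · exact absurd rfl hne
    · by_cases hp : T.parent v = a
      · exact ⟨v, self_mem_branch hv, hp⟩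
      · obtain ⟨c, hc, hca⟩ := ih h hp
        exact ⟨c, by rw [branch_eq_insert hv]; exact Finset.mem_insert_of_mem hc, hca⟩

/-- The distance of two nodes is at least the total weight of the edges separating them. -/
theorem sum_edgeWeight_symmDiff_le_nodeDist (F : Finset V) (hF : T.root ∉ F) (u v : V) :
    (∑ a ∈ F with ¬ (a ∈ T.branch u ↔ a ∈ T.branch v), T.edgeWeight a) ≤ T.nodeDist u v := by
  have key : ∀ {u v : V} (p : T.graph.Walk u v),
      (∑ a ∈ F with ¬ (a ∈ T.branch u ↔ a ∈ T.branch v), T.edgeWeight a) ≤ T.walkWeight p := by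
    intro u v p
    have hw : ∀ a ∈ F, 0 ≤ T.edgeWeight a := fun a ha =>
      (edgeWeight_pos (by rintro rfl; exact hF ha)).le
    induction p with
    | nil => simp [walkWeight]
    | @cons x y z hxy p ih =>
      have h1 : (∑ a ∈ F with ¬ (a ∈ T.branch x ↔ a ∈ T.branch z), T.edgeWeight a) ≤
          (∑ a ∈ F with ¬ (a ∈ T.branch x ↔ a ∈ T.branch y), T.edgeWeight a) +
          (∑ a ∈ F with ¬ (a ∈ T.branch y ↔ a ∈ T.branch z), T.edgeWeight a) := by
        simp only [Finset.sum_filter]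
        rw [← Finset.sum_add_distrib]
        apply Finset.sum_le_sum
        intro a ha
        have := hw a ha
        by_cases q1 : a ∈ T.branch x <;> by_cases q2 : a ∈ T.branch y <;>
          by_cases q3 : a ∈ T.branch z <;> simp [q1, q2, q3] <;> linarith
      have h2 : (∑ a ∈ F with ¬ (a ∈ T.branch x ↔ a ∈ T.branch y), T.edgeWeight a) ≤
          T.weight s(x, y) := by
        have single : ∀ c, c ≠ T.root → T.edgeWeight c = T.weight s(x, y) →
            (∀ a, ¬ (a ∈ T.branch x ↔ a ∈ T.branch y) → a = c) →
            (∑ a ∈ F with ¬ (a ∈ T.branch x ↔ a ∈ T.branch y), T.edgeWeight a) ≤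
              T.weight s(x, y) := by
          intro c hc hcw hcu
          calc _ ≤ ∑ a ∈ ({c} : Finset V), T.edgeWeight a := by
                apply Finset.sum_le_sum_of_subset_of_nonneg
                · intro a ha
                  simpa using hcu a (Finset.mem_filter.1 ha).2
                · intro a ha _
                  rw [Finset.mem_singleton.1 ha]
                  exact (edgeWeight_pos hc).le
            _ = _ := by simp [hcw]
        rcases adj_cases hxy with ⟨hy, hp⟩ | ⟨hx, hp⟩
        · refine single y hy (by rw [edgeWeight, hp]) ?_
          intro a ha
          by_contra hne
          apply ha
          rw [branch_eq_insert hy, hp]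
          simp [hne]
        · refine single x hx (by rw [edgeWeight, hp, Sym2.eq_swap]) ?_
          intro a ha
          by_contra hne
          apply ha
          rw [branch_eq_insert hx, hp]
          simp [hne]
      have h3 : T.walkWeight (SimpleGraph.Walk.cons hxy p) =
          T.weight s(x, y) + T.walkWeight p := by simp [walkWeight]
      linarith
  exact key _

end WeightedTree

/-! ### The one-dimensional potential -/

namespace InfiniteServer

open MeasureTheory intervalIntegral

/-- The marginal value of additional mass beyond `t`, for a comparator with `h` servers. -/
def rate (h : ℕ) (t : ℝ) : ℝ := min 1 (h / (t + 1))

/-- The value of the mass `x` for a comparator with `h` servers: the integral of `rate h`,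
cut off at mass `K * h`. -/
def value (K h : ℕ) (x : ℝ) : ℝ := ∫ t in (0 : ℝ)..min x (K * h), rate h t

theorem rate_nonneg (h : ℕ) {t : ℝ} (ht : 0 ≤ t) : 0 ≤ rate h t := by
  unfold rate; positivity

theorem rate_le_one (h : ℕ) (t : ℝ) : rate h t ≤ 1 := min_le_left _ _

theorem rate_antitone (h : ℕ) {s t : ℝ} (hs : 0 ≤ s) (hst : s ≤ t) : rate h t ≤ rate h s := by
  unfold rate
  gcongr

theorem rate_intervalIntegrable (h : ℕ) {u v : ℝ} (hu : 0 ≤ u) (hv : 0 ≤ v) :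
    IntervalIntegrable (rate h) volume u v := by
  apply AntitoneOn.intervalIntegrable
  intro s hs t ht hst
  rw [Set.mem_uIcc] at hs
  refine rate_antitone h ?_ hst
  rcases hs with hs | hs <;> linarith

theorem integral_rate_sub (h : ℕ) {u v : ℝ} (hu : 0 ≤ u) (hv : 0 ≤ v) :
    (∫ t in (0 : ℝ)..v, rate h t) - ∫ t in (0 : ℝ)..u, rate h t = ∫ t in u..v, rate h t := by
  exact integral_interval_sub_left (rate_intervalIntegrable h le_rfl hv)
    (rate_intervalIntegrable h le_rfl hu)

theorem integral_rate_nonneg (h : ℕ) {u v : ℝ} (hu : 0 ≤ u) (huv : u ≤ v) :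
    0 ≤ ∫ t in u..v, rate h t :=
  intervalIntegral.integral_nonneg huv fun _ ht => rate_nonneg h (hu.trans ht.1)

theorem integral_rate_le (h : ℕ) {u v : ℝ} (hu : 0 ≤ u) (huv : u ≤ v) :
    ∫ t in u..v, rate h t ≤ (v - u) * rate h u := by
  have := integral_mono_on huv (rate_intervalIntegrable h hu (hu.trans huv))
    (intervalIntegrable_const (c := rate h u)) fun t ht => rate_antitone h hu ht.1
  simpa using this

theorem le_integral_rate (h : ℕ) {u v : ℝ} (hu : 0 ≤ u) (huv : u ≤ v) :
    (v - u) * rate h v ≤ ∫ t in u..v, rate h t := by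
  have := integral_mono_on huv (intervalIntegrable_const (c := rate h v))
    (rate_intervalIntegrable h hu (hu.trans huv)) fun t ht => rate_antitone h (hu.trans ht.1) ht.2
  simpa using this

theorem value_zero_mass (K h : ℕ) : value K h 0 = 0 := by
  have : min (0 : ℝ) (K * h) = 0 := min_eq_left (by positivity)
  simp [value, this]

theorem value_zero_servers (K : ℕ) {x : ℝ} (hx : 0 ≤ x) : value K 0 x = 0 := by
  simp [value, hx]

theorem value_mono_mass (K h : ℕ) {x y : ℝ} (hx : 0 ≤ x) (hxy : x ≤ y) :
    value K h x ≤ value K h y := by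
  have h0 : 0 ≤ min x (K * h : ℝ) := le_min hx (by positivity)
  have h1 : min x (K * h : ℝ) ≤ min y (K * h : ℝ) := min_le_min_right _ hxy
  have := integral_rate_sub h h0 (h0.trans h1)
  have := integral_rate_nonneg h h0 h1
  unfold value; linarith

/-- The potential change on the request branch, where the mass increases by at most `1`. -/
theorem min_mul_le_value_sub (K h : ℕ) {x y : ℝ} (hx : 0 ≤ x) (hxy : x ≤ y) (hyx : y ≤ x + 1)
    (hy : y < K * h) :
    min (x + 1) h * ((y - x) / (x + 2)) ≤ value K h y - value K h x := by
  rw [value, value, min_eq_left hy.le, min_eq_left (hxy.trans hy.le),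
    integral_rate_sub h hx (hx.trans hxy)]
  refine le_trans ?_ (le_integral_rate h hx hxy)
  have : min (x + 1) (h : ℝ) / (x + 2) ≤ rate h y := by
    refine le_min ?_ ?_
    · rw [div_le_one (by linarith)]; exact (min_le_left _ _).trans (by linarith)
    · exact div_le_div₀ (Nat.cast_nonneg h) (min_le_right _ _) (by linarith) (by linarith)
  calc _ = (y - x) * (min (x + 1) (h : ℝ) / (x + 2)) := by ring
    _ ≤ _ := by gcongr

/-- The potential change away from the request branch, where the mass decreases by at most
`1`. -/
theorem value_sub_le_min_mul (K h : ℕ) {x y : ℝ} (hy : 0 ≤ y) (hyx : y ≤ x) (hxy : x ≤ y + 1) :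
    value K h x - value K h y ≤ min x h * ((x - y) / x) := by
  rcases hyx.eq_or_lt with rfl | hlt
  · simp
  have hx : 0 < x := hy.trans_lt hlt
  have h1 : value K h x - value K h y ≤ (x - y) * rate h y := by
    by_cases hK : y ≤ K * h
    · have h0 : y ≤ min x (K * h) := le_min hyx hK
      rw [value, value, min_eq_left hK, integral_rate_sub h hy (hy.trans h0)]
      refine (integral_rate_le h hy h0).trans ?_
      have := rate_nonneg h hy
      gcongr
      exact min_le_left _ _
    · push Not at hK
      rw [value, value, min_eq_right hK.le, min_eq_right (hK.le.trans hyx), sub_self]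
      exact mul_nonneg (by linarith) (rate_nonneg h hy)
  refine h1.trans ?_
  have : rate h y ≤ min x (h : ℝ) / x := by
    rw [← min_div_div_right hx.le, div_self hx.ne']
    unfold rate
    gcongr
  calc _ ≤ (x - y) * (min x (h : ℝ) / x) := by gcongr
    _ = _ := by ring

theorem value_eq_of_le {K h : ℕ} {x y : ℝ} (hx : K * h ≤ x) (hy : (K * h : ℝ) ≤ y) :
    value K h x = value K h y := by
  rw [value, value, min_eq_right hx, min_eq_right hy]

/-- One more comparator server raises the value by at most `2 * K`: the rate grows by at most
`1 / h` below the cutoff `K * h`, and the cutoff itself moves by `K`. -/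
theorem value_succ_sub (K h : ℕ) {x : ℝ} (hx : 0 ≤ x) :
    0 ≤ value K (h + 1) x - value K h x ∧ value K (h + 1) x - value K h x ≤ 2 * K := by
  set m := min x (K * h : ℝ)
  set m' := min x (K * (h + 1 : ℕ) : ℝ)
  have hm : 0 ≤ m := le_min hx (by positivity)
  have hmm : m ≤ m' := min_le_min_left _ (by push_cast; nlinarith [Nat.cast_nonneg (α := ℝ) K])
  have hm' : 0 ≤ m' := hm.trans hmm
  have e : value K (h + 1) x - value K h x =
      (∫ t in (0 : ℝ)..m, (rate (h + 1) t - rate h t)) + ∫ t in m..m', rate (h + 1) t := by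
    rw [integral_sub (rate_intervalIntegrable _ le_rfl hm) (rate_intervalIntegrable _ le_rfl hm),
      ← integral_rate_sub _ hm hm']
    simp only [value, m, m']; ring
  have hr : ∀ t : ℝ, 0 ≤ t → 0 ≤ rate (h + 1) t - rate h t := by
    intro t ht
    rw [sub_nonneg]
    unfold rate
    gcongr
    simp
  have hr' : 1 ≤ h → ∀ t : ℝ, 0 ≤ t → rate (h + 1) t - rate h t ≤ 1 / h := by
    intro hh t ht
    have hh' : (1 : ℝ) ≤ h := by exact_mod_cast hh
    rcases le_total (t + 1) h with hth | hth
    · have : rate h t = 1 := min_eq_left (by rw [le_div_iff₀ (by linarith)]; linarith)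
      have := rate_le_one (h + 1) t
      have : (0 : ℝ) ≤ 1 / h := by positivity
      linarith
    · have e1 : rate h t = h / (t + 1) :=
        min_eq_right (by rw [div_le_iff₀ (by linarith)]; linarith)
      have e2 : rate (h + 1) t ≤ (h + 1 : ℕ) / (t + 1) := min_le_right _ _
      have e3 : ((h + 1 : ℕ) : ℝ) / (t + 1) - h / (t + 1) = 1 / (t + 1) := by
        rw [← sub_div]; push_cast; ring
      have : (1 : ℝ) / (t + 1) ≤ 1 / h := by gcongr
      linarith
  have A0 : 0 ≤ ∫ t in (0 : ℝ)..m, (rate (h + 1) t - rate h t) :=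
    intervalIntegral.integral_nonneg hm fun t ht => hr t ht.1
  have A1 : ∫ t in (0 : ℝ)..m, (rate (h + 1) t - rate h t) ≤ K := by
    rcases Nat.eq_zero_or_pos h with rfl | hh
    · have : m = 0 := by simp [m, hx]
      rw [this]; simp
    · have := integral_mono_on hm ((rate_intervalIntegrable (h + 1) le_rfl hm).sub
        (rate_intervalIntegrable h le_rfl hm)) (intervalIntegrable_const (c := (1 / h : ℝ)))
        fun t ht => hr' hh t ht.1
      refine this.trans ?_
      have hh' : (0 : ℝ) < h := by exact_mod_cast hh
      have hmK : m ≤ K * h := min_le_right _ _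
      simp only [intervalIntegral.integral_const, sub_zero, smul_eq_mul, mul_one_div]
      rwa [div_le_iff₀ hh']
  have B0 := integral_rate_nonneg (h + 1) hm hmm
  have B1 : ∫ t in m..m', rate (h + 1) t ≤ K := by
    refine (integral_rate_le (h + 1) hm hmm).trans ?_
    have hd : m' - m ≤ K := by
      have : m' ≤ m + K := by
        simp only [m, m']
        rw [← min_add_add_right]
        refine min_le_min (by simp) (by push_cast; linarith)
      linarith
    have := rate_le_one (h + 1) m
    have := rate_nonneg (h + 1) hm
    nlinarith
  rw [e]
  constructor <;> linarith

theorem value_mono_servers (K : ℕ) {h h' : ℕ} (hh : h ≤ h') {x : ℝ} (hx : 0 ≤ x) :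
    value K h x ≤ value K h' x := by
  induction h', hh using Nat.le_induction with
  | base => exact le_rfl
  | succ n _ ih => have := (value_succ_sub K n hx).1; linarith

theorem value_sub_le (K : ℕ) {h h' : ℕ} (hh : h ≤ h') {x : ℝ} (hx : 0 ≤ x) :
    value K h' x - value K h x ≤ 2 * K * ((h' : ℝ) - h) := by
  induction h', hh using Nat.le_induction with
  | base => simp
  | succ n _ ih => have := (value_succ_sub K n hx).2; push_cast; linarith

theorem abs_value_sub_le (K h h' : ℕ) {x : ℝ} (hx : 0 ≤ x) :
    |value K h x - value K h' x| ≤ 2 * K * |(h : ℝ) - h'| := by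
  rcases le_total h h' with hh | hh
  · have h1 : (h : ℝ) ≤ h' := by exact_mod_cast hh
    rw [abs_sub_comm, abs_sub_comm (h : ℝ),
      abs_of_nonneg (sub_nonneg.2 (value_mono_servers K hh hx)), abs_of_nonneg (sub_nonneg.2 h1)]
    exact value_sub_le K hh hx
  · have h1 : (h' : ℝ) ≤ h := by exact_mod_cast hh
    rw [abs_of_nonneg (sub_nonneg.2 (value_mono_servers K hh hx)), abs_of_nonneg (sub_nonneg.2 h1)]
    exact value_sub_le K hh hx

end InfiniteServer

/-! ### Projecting a mass distribution onto the constraint of a request -/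

namespace InfiniteServer

open Filter Topology

variable {V : Type u}

/-- The sum of `f` over the children of `v` in the finite node set `S`. -/
def childSum (par : V → V) (S : Finset V) (f : V → ℝ) (v : V) : ℝ :=
  ∑ c ∈ S with par c = v, f c

/-- The mass distributions on `S` that the projection of `x` ranges over, where `z v` is the mass
in the subtree of `v`. The demand `q` is the mass required at the nodes themselves, and `p` is the
indicator of the branch of the request: away from that branch no mass may appear where there was
none. -/
structure Admissible (par : V → V) (S : Finset V) (x p q z : V → ℝ) : Prop where
  nonneg : ∀ v ∈ S, 0 ≤ z v
  frozen : ∀ v ∈ S, x v + 2 * p v = 0 → z v = 0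
  zero_off : ∀ v ∉ S, z v = 0
  sum_le : ∀ v ∈ S, childSum par S z v + q v ≤ z v

/-- The quadratic movement penalty minimized by the projection. The summand `2 * p v` lets mass
enter empty subtrees on the branch of the request; it is `2` because a mass that rises from `x` by
at most `1` earns at least `min 1 (h / (x + 2))` per unit. Where the denominator vanishes, an
admissible `z v` equals `x v = 0`. -/
def energy (S : Finset V) (w x p z : V → ℝ) : ℝ :=
  ∑ v ∈ S, w v * ((z v - x v) ^ 2 / (x v + 2 * p v))

/-- The lower end of the range in which the mass of `v` moves during one request. -/
def lower (x p : V → ℝ) (v : V) : ℝ := max (x v - 1 + p v) 0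

/-- Truncation of a mass distribution to the range allowed for one request. -/
def clamp (S : Finset V) (x p z : V → ℝ) (v : V) : ℝ :=
  if v ∈ S then max (lower x p v) (min (z v) (x v + p v)) else 0

variable {par : V → V} {S : Finset V} {w x p q z : V → ℝ}

theorem lower_le (hx : ∀ v, 0 ≤ x v) (hp : ∀ v, p v = 0 ∨ p v = 1) (v : V) : lower x p v ≤ x v := by
  have := hx v
  refine max_le ?_ this
  rcases hp v with h | h <;> rw [h] <;> linarith

/-- Truncation keeps admissibility: if it raises the mass of some child of `v`, then that child
loses a whole unit compared to the upper ends, and so the lower end at `v` suffices. -/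
theorem Admissible.clamp (hx : ∀ v, 0 ≤ x v) (hp : ∀ v, p v = 0 ∨ p v = 1)
    (hxs : ∀ v ∈ S, childSum par S x v ≤ x v) (hps : ∀ v ∈ S, childSum par S p v + q v = p v)
    (hz : Admissible par S x p q z) : Admissible par S x p q (clamp S x p z) where
  nonneg v hv := by
    rw [InfiniteServer.clamp, if_pos hv]
    exact le_max_of_le_left (le_max_right _ _)
  frozen v hv h := by
    have h1 := hx v
    have h2 : x v = 0 ∧ p v = 0 := by
      rcases hp v with h | h <;> constructor <;> linarith
    rw [InfiniteServer.clamp, if_pos hv, lower, hz.frozen v hv h, h2.1, h2.2]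
    norm_num
  zero_off v hv := by rw [InfiniteServer.clamp, if_neg hv]
  sum_le v hv := by
    have hp0 : ∀ v, 0 ≤ p v := fun v => by rcases hp v with h | h <;> rw [h]; norm_num
    have hle : ∀ c ∈ S, InfiniteServer.clamp S x p z c ≤ x c + p c := fun c hc => by
      rw [InfiniteServer.clamp, if_pos hc]
      refine max_le ((lower_le hx hp c).trans ?_) (min_le_right _ _)
      linarith [hp0 c]
    have hsum : childSum par S (fun c => x c + p c) v + q v ≤ x v + p v := by
      have := hxs v hv
      have := hps v hv
      simp only [childSum, Finset.sum_add_distrib] at *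
      linarith
    by_cases hex : ∃ c ∈ S, par c = v ∧ z c < lower x p c
    · obtain ⟨c, hc, hcv, hlt⟩ := hex
      have hl : lower x p c = x c - 1 + p c := by
        have h0 := hz.nonneg c hc
        rcases max_choice (x c - 1 + p c) 0 with h | h
        · exact h
        · rw [lower, h] at hlt; linarith
      have h1 : childSum par S (InfiniteServer.clamp S x p z) v ≤
          childSum par S (fun c => x c + p c) v - 1 := by
        have hmem : c ∈ S.filter (par · = v) := Finset.mem_filter.2 ⟨hc, hcv⟩
        rw [childSum, childSum, ← Finset.add_sum_erase _ _ hmem, ← Finset.add_sum_erase _ _ hmem]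
        have h2 : InfiniteServer.clamp S x p z c = x c - 1 + p c := by
          rw [InfiniteServer.clamp, if_pos hc, ← hl, max_eq_left]
          exact (min_le_left _ _).trans hlt.le
        have h3 : ∑ a ∈ (S.filter (par · = v)).erase c, InfiniteServer.clamp S x p z a ≤
            ∑ a ∈ (S.filter (par · = v)).erase c, (x a + p a) :=
          Finset.sum_le_sum fun a ha => hle a (Finset.mem_filter.1 (Finset.mem_of_mem_erase ha)).1
        linarith
      have h2 : x v - 1 + p v ≤ InfiniteServer.clamp S x p z v := by
        rw [InfiniteServer.clamp, if_pos hv]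
        exact le_max_of_le_left (le_max_left _ _)
      linarith
    · push Not at hex
      have hc : ∀ c ∈ S, par c = v → InfiniteServer.clamp S x p z c ≤ z c := fun c hc hcv => by
        rw [InfiniteServer.clamp, if_pos hc]
        exact max_le (hex c hc hcv) (min_le_left _ _)
      rw [show InfiniteServer.clamp S x p z v = _ from if_pos hv]
      refine le_max_of_le_right (le_min ?_ ?_)
      · refine le_trans ?_ (hz.sum_le v hv)
        refine add_le_add_left (Finset.sum_le_sum fun c h => ?_) _
        exact hc c (Finset.mem_filter.1 h).1 (Finset.mem_filter.1 h).2
      · refine le_trans ?_ hsum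
        refine add_le_add_left (Finset.sum_le_sum fun c h => ?_) _
        exact hle c (Finset.mem_filter.1 h).1

theorem energy_clamp_le (hw : ∀ v ∈ S, 0 ≤ w v) (hx : ∀ v, 0 ≤ x v) (hp : ∀ v, p v = 0 ∨ p v = 1) :
    energy S w x p (clamp S x p z) ≤ energy S w x p z := by
  refine Finset.sum_le_sum fun v hv => ?_
  have hp0 : 0 ≤ p v := by rcases hp v with h | h <;> rw [h]; norm_num
  have hx0 := hx v
  have h0 := hw v hv
  gcongr ?_ * (?_ / ?_)
  rw [sq_le_sq, clamp, if_pos hv]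
  have hl := lower_le hx hp v
  rcases le_total (z v) (x v + p v) with h1 | h1
  · rw [min_eq_left h1]
    rcases le_total (lower x p v) (z v) with h2 | h2
    · rw [max_eq_right h2]
    · rw [max_eq_left h2, abs_of_nonpos (by linarith), abs_of_nonpos (by linarith)]
      linarith
  · rw [min_eq_right h1, max_eq_right (by linarith), abs_of_nonneg (by linarith),
      abs_of_nonneg (by linarith)]
    linarith

/-- The energy has a minimizer on the admissible set, and there the mass of no node leaves its range
for one request. The minimizer is found on the compact set of truncated distributions; truncation
does not increase the energy, so it is a minimizer among all admissible ones. -/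
theorem exists_isMinOn_energy (hw : ∀ v ∈ S, 0 ≤ w v) (hx : ∀ v, 0 ≤ x v)
    (hp : ∀ v, p v = 0 ∨ p v = 1) (hxs : ∀ v ∈ S, childSum par S x v ≤ x v)
    (hps : ∀ v ∈ S, childSum par S p v + q v = p v) :
    ∃ y, Admissible par S x p q y ∧ (∀ v ∈ S, lower x p v ≤ y v ∧ y v ≤ x v + p v) ∧
      ∀ z, Admissible par S x p q z → energy S w x p y ≤ energy S w x p z := by
  have hp0 : ∀ v, 0 ≤ p v := fun v => by rcases hp v with h | h <;> rw [h]; norm_num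
  have hlx := lower_le hx hp
  set B : Set (V → ℝ) := {z | (∀ v, z v ∈ Set.Icc (if v ∈ S then lower x p v else 0)
    (if v ∈ S then x v + p v else 0)) ∧ ∀ v ∈ S, childSum par S z v + q v ≤ z v} with hB
  have hBadm : ∀ z ∈ B, Admissible par S x p q z ∧
      ∀ v ∈ S, lower x p v ≤ z v ∧ z v ≤ x v + p v := by
    rintro z ⟨h1, h2⟩
    have h3 : ∀ v ∈ S, lower x p v ≤ z v ∧ z v ≤ x v + p v := fun v hv => by
      simpa [hv] using h1 v
    have h4 : ∀ v ∈ S, 0 ≤ z v := fun v hv => (le_max_right _ _).trans (h3 v hv).1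
    refine ⟨⟨h4, fun v hv h => ?_, fun v hv => ?_, h2⟩, h3⟩
    · have := hx v
      have := hp0 v
      linarith [h3 v hv, h4 v hv]
    · have := h1 v
      simp only [hv, if_false, Set.Icc_self, Set.mem_singleton_iff] at this
      exact this
  have hclosed : IsClosed {z : V → ℝ | ∀ v ∈ S, childSum par S z v + q v ≤ z v} := by
    simp only [Set.ofPred_forall, childSum]
    exact isClosed_iInter fun v => isClosed_iInter fun _ =>
      isClosed_le (by fun_prop) (by fun_prop)
  have hcompact : IsCompact B := by
    refine IsCompact.inter_right (s := {z : V → ℝ | ∀ v, z v ∈ Set.Icc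
      (if v ∈ S then lower x p v else 0) (if v ∈ S then x v + p v else 0)}) ?_ hclosed
    exact isCompact_pi_infinite fun v => isCompact_Icc
  have hne : B.Nonempty := by
    refine ⟨fun v => if v ∈ S then x v + p v else 0, fun v => ?_, fun v hv => ?_⟩
    · by_cases hv : v ∈ S
      · have := hlx v
        have := hp0 v
        simp only [hv, if_true, Set.mem_Icc, le_refl, and_true]
        linarith
      · simp [hv]
    · have h1 := hxs v hv
      have h2 := hps v hv
      have h3 : childSum par S (fun v => if v ∈ S then x v + p v else 0) v =
          childSum par S x v + childSum par S p v := by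
        rw [childSum, childSum, childSum, ← Finset.sum_add_distrib]
        exact Finset.sum_congr rfl fun c hc => if_pos (Finset.mem_filter.1 hc).1
      simp only [hv, if_true]
      linarith
  have hcont : Continuous (energy S w x p) := by
    unfold energy
    fun_prop
  obtain ⟨y, hyB, hy⟩ := hcompact.exists_isMinOn hne hcont.continuousOn
  obtain ⟨hy1, hy2⟩ := hBadm y hyB
  refine ⟨y, hy1, hy2, fun z hz => le_trans (hy ?_) (energy_clamp_le hw hx hp)⟩
  have hzc := hz.clamp hx hp hxs hps
  refine ⟨fun v => ?_, hzc.sum_le⟩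
  by_cases hv : v ∈ S
  · have := hlx v
    have := hp0 v
    simp only [clamp, hv, if_true, Set.mem_Icc]
    exact ⟨le_max_left _ _, max_le (by linarith) (min_le_right _ _)⟩
  · simp [clamp, hv]

/-- The variational inequality of the projection, in a direction `-U` that does not leave the
admissible set. -/
theorem sum_mul_le_zero_of_isMin {y U : V → ℝ} (hy : Admissible par S x p q y)
    (hmin : ∀ z, Admissible par S x p q z → energy S w x p y ≤ energy S w x p z)
    (hU0 : ∀ v ∈ S, y v = 0 → U v ≤ 0) (hUf : ∀ v ∈ S, x v + 2 * p v = 0 → U v = 0)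
    (hUs : ∀ v ∈ S, childSum par S y v + q v = y v → U v ≤ childSum par S U v) :
    ∑ v ∈ S, w v * ((y v - x v) / (x v + 2 * p v) * U v) ≤ 0 := by
  set Z : ℝ → V → ℝ := fun ε v => if v ∈ S then y v - ε * U v else 0 with hZ
  have hZs : ∀ ε v, childSum par S (Z ε) v = childSum par S y v - ε * childSum par S U v := by
    intro ε v
    rw [childSum, childSum, childSum, Finset.mul_sum, ← Finset.sum_sub_distrib]
    exact Finset.sum_congr rfl fun c hc => if_pos (Finset.mem_filter.1 hc).1
  have hlim : ∀ a b : ℝ, Tendsto (fun ε : ℝ => a - ε * b) (𝓝[>] 0) (𝓝 a) := by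
    intro a b
    have : Tendsto (fun ε : ℝ => a - ε * b) (𝓝 0) (𝓝 (a - 0 * b)) :=
      Continuous.tendsto (by fun_prop) 0
    simp only [zero_mul, sub_zero] at this
    exact this.mono_left nhdsWithin_le_nhds
  have hpos : ∀ᶠ ε : ℝ in 𝓝[>] 0, 0 < ε := eventually_mem_nhdsWithin
  have h1 : ∀ᶠ ε in 𝓝[>] (0 : ℝ), ∀ v ∈ S, 0 ≤ Z ε v := by
    rw [Filter.eventually_all_finset]
    intro v hv
    simp only [hZ, hv, if_true]
    rcases (hy.nonneg v hv).eq_or_lt with h | h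
    · filter_upwards [hpos] with ε hε
      have := hU0 v hv h.symm
      nlinarith
    · filter_upwards [(hlim (y v) (U v)).eventually (lt_mem_nhds h)] with ε hε
      exact hε.le
  have h2 : ∀ᶠ ε in 𝓝[>] (0 : ℝ), ∀ v ∈ S, childSum par S (Z ε) v + q v ≤ Z ε v := by
    rw [Filter.eventually_all_finset]
    intro v hv
    simp only [hZs]
    simp only [hZ, hv, if_true]
    rcases (hy.sum_le v hv).eq_or_lt with h | h
    · filter_upwards [hpos] with ε hε
      have := hUs v hv h
      nlinarith
    · have h' : 0 < y v - (childSum par S y v + q v) := by linarith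
      filter_upwards [(hlim _ (U v - childSum par S U v)).eventually (lt_mem_nhds h')] with ε hε
      nlinarith
  have h3 : ∀ᶠ ε in 𝓝[>] (0 : ℝ), 2 * ∑ v ∈ S, w v * ((y v - x v) / (x v + 2 * p v) * U v) ≤
      0 - ε * -(∑ v ∈ S, w v * (U v ^ 2 / (x v + 2 * p v))) := by
    filter_upwards [hpos, h1, h2] with ε hε h1 h2
    have hadm : Admissible par S x p q (Z ε) := by
      refine ⟨h1, fun v hv h => ?_, fun v hv => if_neg hv, h2⟩
      simp only [hZ, hv, if_true, hy.frozen v hv h, hUf v hv h]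
      simp
    have h4 := hmin _ hadm
    have h5 : energy S w x p (Z ε) = energy S w x p y
        - 2 * ε * ∑ v ∈ S, w v * ((y v - x v) / (x v + 2 * p v) * U v)
        + ε ^ 2 * ∑ v ∈ S, w v * (U v ^ 2 / (x v + 2 * p v)) := by
      rw [energy, energy, Finset.mul_sum, Finset.mul_sum, ← Finset.sum_sub_distrib,
        ← Finset.sum_add_distrib]
      refine Finset.sum_congr rfl fun v hv => ?_
      simp only [hZ, hv, if_true]
      ring
    have h6 : 0 ≤ ε * (0 - ε * -(∑ v ∈ S, w v * (U v ^ 2 / (x v + 2 * p v))) -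
        2 * ∑ v ∈ S, w v * ((y v - x v) / (x v + 2 * p v) * U v)) := by
      linarith
    have := nonneg_of_mul_nonneg_right h6 hε
    linarith
  have := ge_of_tendsto (hlim 0 _) h3
  linarith

end InfiniteServer

/-! ### The fractional potential -/

namespace InfiniteServer

variable {V : Type u}

/-- The potential, per unit of edge weight, of mass `x` in a subtree at level `l` in which the
comparator has `h` servers. -/
def massPotential (b l h : ℕ) (x : ℝ) : ℝ := 2 * l * x - b * value b h x

/-- The direction used in the variational inequality: a bound for the derivative of the
potential. -/
def slope (b l h : ℕ) (x p y : ℝ) : ℝ :=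
  (2 * l + p) * (y + 2 * p) - if y < b * h then b * min (x + p) h else 0

/-- The change of the potential at one node, together with the mass moved downwards into its
subtree, is at most the term of that node in the variational inequality for the direction
`slope`. -/
theorem massPotential_sub_le (b l h : ℕ) {x p y : ℝ} (hx : 0 ≤ x) (hp : p = 0 ∨ p = 1)
    (hl : max (x - 1 + p) 0 ≤ y) (hu : y ≤ x + p) :
    p * (y - x) + (massPotential b l h y - massPotential b l h x) ≤
      (y - x) / (x + 2 * p) * slope b l h x p y := by
  have hy1 := (le_max_left _ _).trans hl
  have hy0 := (le_max_right _ _).trans hl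
  have hb : (0 : ℝ) ≤ b := Nat.cast_nonneg b
  have hl0 : (0 : ℝ) ≤ l := Nat.cast_nonneg l
  unfold massPotential slope
  rcases hp with rfl | rfl
  · rw [add_zero] at hu
    rcases hx.eq_or_lt with rfl | hx'
    · have : y = 0 := le_antisymm hu hy0
      simp [this]
    have e : (y - x) = -((x - y) / x) * x := by field_simp; ring
    have hn : 0 ≤ (x - y) / x := div_nonneg (by linarith) hx
    have hd : (y - x) / (x + 2 * 0) = -((x - y) / x) := by
      rw [mul_zero, add_zero, ← neg_div, neg_sub]
    rw [hd]
    set D := (x - y) / x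
    have h1 : l * (y - x) ≤ -D * l * y := by
      rw [e]
      have : D * l * y ≤ D * l * x := mul_le_mul_of_nonneg_left hu (mul_nonneg hn hl0)
      linarith
    split_ifs with hlt
    · have h2 := value_sub_le_min_mul b h hy0 hu (by linarith)
      have h3 : b * (value b h x - value b h y) ≤ b * (min x h * D) :=
        mul_le_mul_of_nonneg_left h2 hb
      simp only [add_zero, mul_zero]
      linarith
    · push Not at hlt
      rw [value_eq_of_le hlt (hlt.trans hu)]
      linarith
  · have hxy : x ≤ y := by linarith
    have e : (y - x) = ((y - x) / (x + 2)) * (x + 2) := by field_simp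
    have hn : 0 ≤ (y - x) / (x + 2) := div_nonneg (by linarith) (by linarith)
    rw [mul_one]
    have h1 : (2 * l + 1) * (y - x) ≤ (y - x) / (x + 2) * ((2 * l + 1) * (y + 2)) := by
      conv_lhs => rw [e]
      have : (y - x) / (x + 2) * (2 * l + 1) * (x + 2) ≤
          (y - x) / (x + 2) * (2 * l + 1) * (y + 2) :=
        mul_le_mul_of_nonneg_left (by linarith) (by positivity)
      linarith
    split_ifs with hlt
    · have h2 := min_mul_le_value_sub b h hx hxy hu hlt
      have h3 := mul_le_mul_of_nonneg_left h2 hb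
      linarith
    · have h3 := mul_le_mul_of_nonneg_left (value_mono_mass b h hx hxy) hb
      linarith

/-- At a node where the mass constraint is tight, the slope is at most the sum of the slopes of
the children. -/
theorem slope_le_childSum {par : V → V} {S : Finset V} {x p q y : V → ℝ} {l h : V → ℕ} {b : ℕ}
    {v : V} (hl : ∀ c ∈ S, par c = v → l c = l v + 1) (hb : 6 * l v + 4 ≤ b)
    (hx : ∀ v, 0 ≤ x v) (hy0 : ∀ v ∈ S, 0 ≤ y v)
    (hp : ∀ v, p v = 0 ∨ p v = 1) (hq : q v = 0 ∨ q v = 1 ∧ p v = 1)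
    (hxs : childSum par S x v ≤ x v) (hps : childSum par S p v + q v = p v)
    (hhs : childSum par S (fun c => h c) v + q v ≤ h v)
    (hv : v ∈ S) (ht : childSum par S y v + q v = y v) :
    slope b (l v) (h v) (x v) (p v) (y v) ≤
      childSum par S (fun c => slope b (l c) (h c) (x c) (p c) (y c)) v := by
  have hb' : (6 * l v + 4 : ℝ) ≤ b := by exact_mod_cast hb
  have hb0 : (0 : ℝ) ≤ b := Nat.cast_nonneg b
  have hl0 : (0 : ℝ) ≤ l v := Nat.cast_nonneg _
  have hm : childSum par S (fun c => min (x c + p c) (h c)) v + q v ≤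
      min (x v + p v) (h v) := by
    refine le_min ?_ ?_
    · have : childSum par S (fun c => min (x c + p c) (h c : ℝ)) v ≤
          childSum par S (fun c => x c + p c) v := Finset.sum_le_sum fun c _ => min_le_left _ _
      have e : childSum par S (fun c => x c + p c) v = childSum par S x v + childSum par S p v :=
        Finset.sum_add_distrib
      linarith
    · have : childSum par S (fun c => min (x c + p c) (h c : ℝ)) v ≤
          childSum par S (fun c => (h c : ℝ)) v := Finset.sum_le_sum fun c _ => min_le_right _ _
      linarith
  have hlow : (2 * l v + 2) * childSum par S y v + 2 * (2 * l v + 3) * childSum par S p v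
      - b * childSum par S (fun c => min (x c + p c) (h c)) v ≤
      childSum par S (fun c => slope b (l c) (h c) (x c) (p c) (y c)) v := by
    simp only [childSum, Finset.mul_sum]
    rw [← Finset.sum_add_distrib, ← Finset.sum_sub_distrib]
    refine Finset.sum_le_sum fun c hc => ?_
    obtain ⟨hc, hcv⟩ := Finset.mem_filter.1 hc
    have hyc := hy0 c hc
    have hlc : (l c : ℝ) = l v + 1 := by rw [hl c hc hcv]; push_cast; ring
    have hm0 : 0 ≤ b * min (x c + p c) (h c : ℝ) := by
      have := hx c
      have : 0 ≤ p c := by rcases hp c with h | h <;> rw [h]; norm_num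
      positivity
    have hif : (if y c < b * h c then b * min (x c + p c) (h c : ℝ) else 0) ≤
        b * min (x c + p c) (h c : ℝ) := by
      split_ifs
      · exact le_rfl
      · exact hm0
    have hmain : (2 * l v + 2) * y c + 2 * (2 * l v + 3) * p c ≤
        (2 * l c + p c) * (y c + 2 * p c) := by
      rw [hlc]
      rcases hp c with h | h <;> rw [h] <;> nlinarith
    unfold slope
    linarith
  have hmv : min (x v + p v) (h v : ℝ) ≤ h v := min_le_right _ _
  have hyv := hy0 v hv
  unfold slope at hlow ⊢
  set M := min (x v + p v) (h v : ℝ)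
  set m := childSum par S (fun c => min (x c + p c) (h c : ℝ)) v
  have hbm : b * (m + q v) ≤ b * M := mul_le_mul_of_nonneg_left hm hb0
  clear_value M m
  refine le_trans ?_ hlow
  have hcy : childSum par S y v = y v - q v := by linarith
  have hcp : childSum par S p v = p v - q v := by linarith
  rw [hcy, hcp]
  split_ifs with hlt
  · rcases hq with hq | ⟨hq, hp1⟩
    · rw [hq] at hbm ⊢
      rcases hp v with hp | hp <;> rw [hp] <;> nlinarith
    · rw [hq] at hbm ⊢
      rw [hp1]; nlinarith
  · push Not at hlt
    have hbM : b * M ≤ b * h v := mul_le_mul_of_nonneg_left hmv hb0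
    rcases hq with hq | ⟨hq, hp1⟩
    · rw [hq] at hbm ⊢
      rcases hp v with hp | hp <;> rw [hp] <;> nlinarith
    · rw [hq] at hbm ⊢
      rw [hp1]; nlinarith

/-- Serving a request with fractional mass: there is a new distribution `y` whose increments on
the branch of the request are paid for by the decrease of the potential, for every comparator `h`
that serves the request. -/
theorem exists_fractional_step {par : V → V} {S : Finset V} {w x p q : V → ℝ} {l : V → ℕ} {b : ℕ}
    (hw : ∀ v ∈ S, 0 ≤ w v) (hl : ∀ v ∈ S, ∀ c ∈ S, par c = v → l c = l v + 1)
    (hb : ∀ v ∈ S, 6 * l v + 4 ≤ b) (hx : ∀ v, 0 ≤ x v)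
    (hp : ∀ v, p v = 0 ∨ p v = 1) (hq : ∀ v, q v = 0 ∨ q v = 1 ∧ p v = 1)
    (hxs : ∀ v ∈ S, childSum par S x v ≤ x v) (hps : ∀ v ∈ S, childSum par S p v + q v = p v) :
    ∃ y, Admissible par S x p q y ∧
      (∀ v ∈ S, (p v = 0 → y v ≤ x v) ∧ (p v = 1 → x v ≤ y v)) ∧
      ∀ h : V → ℕ, (∀ v ∈ S, childSum par S (fun c => h c) v + q v ≤ h v) →
        (∀ v ∈ S, p v = 1 → 1 ≤ h v) →
        ∑ v ∈ S, w v * (p v * (y v - x v)) + ∑ v ∈ S, w v *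
          (massPotential b (l v) (h v) (y v) - massPotential b (l v) (h v) (x v)) ≤ 0 := by
  obtain ⟨y, hy, hbox, hmin⟩ := exists_isMinOn_energy hw hx hp hxs hps
  refine ⟨y, hy, fun v hv => ⟨fun h => ?_, fun h => ?_⟩, fun h hh hh1 => ?_⟩
  · have := (hbox v hv).2; rw [h] at this; linarith
  · have := (le_max_left _ _).trans (hbox v hv).1; rw [h] at this; linarith
  rw [← Finset.sum_add_distrib]
  refine le_trans (Finset.sum_le_sum fun v hv => ?_) (sum_mul_le_zero_of_isMin hy hmin
    (U := fun v => slope b (l v) (h v) (x v) (p v) (y v)) ?_ ?_ ?_)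
  · rw [← mul_add]
    exact mul_le_mul_of_nonneg_left (massPotential_sub_le b (l v) (h v) (hx v) (hp v)
      (hbox v hv).1 (hbox v hv).2) (hw v hv)
  · intro v hv hyv
    have hb' : (6 * l v + 4 : ℝ) ≤ b := by exact_mod_cast hb v hv
    have hb0 : (0 : ℝ) ≤ b := Nat.cast_nonneg b
    have hl0 : (0 : ℝ) ≤ l v := Nat.cast_nonneg _
    simp only [slope, hyv]
    rcases hp v with hpv | hpv
    · rw [hpv]
      have : 0 ≤ if (0 : ℝ) < b * h v then (b * min (x v + 0) (h v) : ℝ) else 0 := by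
        have := hx v
        split_ifs <;> positivity
      linarith
    · have h1 : (1 : ℝ) ≤ h v := by exact_mod_cast hh1 v hv hpv
      have hx0 := hx v
      have h2 : (1 : ℝ) ≤ min (x v + 1) (h v) := le_min (by linarith) h1
      have h3 : (0 : ℝ) < b * h v := by nlinarith
      rw [hpv, if_pos h3]
      nlinarith
  · intro v hv h0
    have hy0 := hy.frozen v hv h0
    have hx0 := hx v
    have h2 : x v = 0 ∧ p v = 0 := by
      rcases hp v with h | h <;> constructor <;> linarith
    simp [slope, hy0, h2.1, h2.2]
  · intro v hv ht
    exact slope_le_childSum (hl v hv) (hb v hv) hx hy.nonneg hp (hq v) (hxs v hv) (hps v hv)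
      (hh v hv) hv ht

end InfiniteServer

/-! ### Rounding the mass of a subtree to a number of servers -/

namespace InfiniteServer

/-- The number of servers that replaces `y` in a subtree at level `i` of a tree of depth `d` when
the mass becomes `x`: the value nearest to `y` between the integer parts of `2dx/(d+i)` and
`2dx/(d+i-1)`, both of which lie between those of `x` and `2x` if `1 ≤ i ≤ d`. The windows of
consecutive levels share an endpoint, so that the numbers of the children of a node sum to at most
its own. -/
def roundServers (d i : ℕ) (x : ℝ) (y : ℕ) : ℕ :=
  max ⌊2 * d * x / (d + i)⌋₊ (min y ⌊2 * d * x / (d + i - 1)⌋₊)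

/-- How far the mass `x` lies below the threshold `y * (d + i) / (2 * d)` at which the number of
servers would rise to `y`, in units of `1 / (2 * d)`. -/
def surplus (d i : ℕ) (x : ℝ) (y : ℕ) : ℝ := max (y * (d + i) - 2 * d * x) 0

theorem roundServers_bounds {d i : ℕ} (hd : 1 ≤ d) (hi : 1 ≤ i) {x : ℝ} (hx : 0 ≤ x) (y : ℕ) :
    roundServers d i x y * (d + i - 1) ≤ 2 * d * x ∧
      2 * d * x < (roundServers d i x y + 1) * (d + i) := by
  have hd' : (1 : ℝ) ≤ d := by exact_mod_cast hd
  have hi' : (1 : ℝ) ≤ i := by exact_mod_cast hi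
  have h1 : (0 : ℝ) < d + i - 1 := by linarith
  have h2 : (0 : ℝ) < d + i := by linarith
  have h0 : (0 : ℝ) ≤ 2 * d * x := by positivity
  have hle : ⌊2 * d * x / (d + i)⌋₊ ≤ ⌊2 * d * x / (d + i - 1)⌋₊ :=
    Nat.floor_le_floor (div_le_div_of_nonneg_left h0 h1 (by linarith))
  constructor
  · rw [← le_div_iff₀ h1]
    refine le_trans ?_ (Nat.floor_le (div_nonneg h0 h1.le))
    exact Nat.cast_le.2 (max_le hle (min_le_right _ _))
  · rw [← div_lt_iff₀ h2]
    refine (Nat.lt_floor_add_one _).trans_le ?_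
    gcongr
    exact le_max_left _ _

/-- The hysteresis: a change of the number of servers is charged to decreases of the mass. A rise
leaves no surplus, and each unit of a fall lowers the surplus by at least one, as the two thresholds
differ by at least `1 / (2 * d)`. -/
theorem abs_roundServers_sub_le {d i : ℕ} (hd : 1 ≤ d) (hi : 1 ≤ i) {x x' : ℝ}
    (hx' : 0 ≤ x') (y : ℕ) :
    |(roundServers d i x' y : ℝ) - y| ≤ (roundServers d i x' y - y) +
      2 * (2 * d * max (x - x') 0 + surplus d i x y - surplus d i x' (roundServers d i x' y)) := by
  have hd' : (1 : ℝ) ≤ d := by exact_mod_cast hd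
  have hi' : (1 : ℝ) ≤ i := by exact_mod_cast hi
  have h1 : (0 : ℝ) < d + i - 1 := by linarith
  have h2 : (0 : ℝ) < d + i := by linarith
  have hs0 : ∀ z k, 0 ≤ surplus d i z k := fun z k => le_max_right _ _
  have hs : surplus d i x' y ≤ 2 * d * max (x - x') 0 + surplus d i x y := by
    refine max_le ?_ ?_
    · have e1 : y * (d + i) - 2 * d * x ≤ surplus d i x y := le_max_left _ _
      have e2 : x - x' ≤ max (x - x') 0 := le_max_left _ _
      nlinarith
    · have := hs0 x y
      have : 0 ≤ max (x - x') 0 := le_max_right _ _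
      positivity
  rcases lt_trichotomy (roundServers d i x' y) y with hlt | heq | hgt
  · have hlt' : (roundServers d i x' y : ℝ) + 1 ≤ y := by exact_mod_cast hlt
    have hup : 2 * d * x' < (roundServers d i x' y + 1) * (d + i - 1) := by
      have hfl : ⌊2 * d * x' / (d + i - 1)⌋₊ ≤ roundServers d i x' y := by
        unfold roundServers at hlt ⊢
        rcases le_total y ⌊2 * d * x' / (d + i - 1)⌋₊ with h | h
        · rw [min_eq_left h] at hlt
          exact absurd hlt (not_lt.2 (le_max_right _ _))
        · rw [min_eq_right h]; exact le_max_right _ _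
      rw [← div_lt_iff₀ h1]
      refine (Nat.lt_floor_add_one _).trans_le ?_
      gcongr
    set y' := roundServers d i x' y
    have e1 : y * (d + i) - 2 * d * x' ≤ surplus d i x' y := le_max_left _ _
    have key : (y : ℝ) - y' ≤ surplus d i x' y - surplus d i x' y' := by
      rcases max_choice (y' * (d + i) - 2 * d * x') 0 with h | h
      · rw [surplus.eq_1 d i x' y', h]
        nlinarith
      · rw [surplus.eq_1 d i x' y', h]
        have : (y' + 1) * (d + i - 1) ≤ y * (d + i - 1 : ℝ) := by gcongr
        have : (0 : ℝ) ≤ y' := Nat.cast_nonneg _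
        linarith
    rw [abs_of_nonpos (by linarith)]
    linarith
  · rw [heq]; simp only [sub_self, abs_zero, zero_add]
    linarith
  · have hgt' : (y : ℝ) ≤ roundServers d i x' y := by exact_mod_cast hgt.le
    have hfl : roundServers d i x' y = ⌊2 * d * x' / (d + i)⌋₊ := by
      unfold roundServers at hgt ⊢
      rcases max_choice ⌊2 * d * x' / (d + i)⌋₊ (min y ⌊2 * d * x' / (d + i - 1)⌋₊) with h | h
      · exact h
      · rw [h] at hgt
        exact absurd (min_le_left _ _) (not_le.2 hgt)
    have hz : surplus d i x' (roundServers d i x' y) = 0 := by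
      refine max_eq_right ?_
      rw [sub_nonpos, hfl, ← le_div_iff₀ h2]
      exact Nat.floor_le (by positivity)
    rw [hz, abs_of_nonneg (by linarith)]
    have := hs0 x' y
    linarith

/-- The potential, per unit of edge weight, of a subtree at level `i` that has mass `x` and `y`
servers, when the comparator has `h` servers in it. -/
def nodePotential (d b i h : ℕ) (x : ℝ) (y : ℕ) : ℝ :=
  -y + 2 * surplus d i x y + 4 * d * x + 4 * d * massPotential b i h x

theorem abs_add_nodePotential_sub_le {d i : ℕ} (hd : 1 ≤ d) (hi : 1 ≤ i) (b h : ℕ) {x x' : ℝ}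
    (hx' : 0 ≤ x') (y : ℕ) :
    |(roundServers d i x' y : ℝ) - y| +
      (nodePotential d b i h x' (roundServers d i x' y) - nodePotential d b i h x y) ≤
      4 * d * (max (x' - x) 0 + (massPotential b i h x' - massPotential b i h x)) := by
  have h1 := abs_roundServers_sub_le hd hi (x := x) hx' y
  have h2 : max (x' - x) 0 = max (x - x') 0 + (x' - x) := by
    rcases le_total x x' with h | h
    · rw [max_eq_left (by linarith), max_eq_right (by linarith)]; ring
    · rw [max_eq_right (by linarith), max_eq_left (by linarith)]; ring
  rw [h2]
  unfold nodePotential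
  linarith

theorem nodePotential_zero (d b i h : ℕ) : nodePotential d b i h 0 0 = 0 := by
  simp [nodePotential, surplus, massPotential, value_zero_mass]

theorem abs_nodePotential_sub_le (d b i h h' : ℕ) {x : ℝ} (hx : 0 ≤ x) (y : ℕ) :
    |nodePotential d b i h x y - nodePotential d b i h' x y| ≤
      8 * d * b ^ 2 * |(h : ℝ) - h'| := by
  have h1 := abs_value_sub_le b h' h hx
  have e : nodePotential d b i h x y - nodePotential d b i h' x y =
      4 * d * b * (value b h' x - value b h x) := by
    unfold nodePotential massPotential; ring
  rw [e, abs_mul, abs_of_nonneg (by positivity), abs_sub_comm (h : ℝ)]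
  calc _ ≤ 4 * d * b * (2 * b * |(h' : ℝ) - h|) := by gcongr
    _ = _ := by ring

/-- The potential is nonnegative without comparator servers, since then `value` vanishes and
`y ≤ 2 * x`; the Lipschitz bound gives the general case. -/
theorem neg_le_nodePotential {d i : ℕ} (hd : 1 ≤ d) (hi : 1 ≤ i) (b h : ℕ) {x : ℝ} (hx : 0 ≤ x)
    {y : ℕ} (hy : y * (d + i - 1) ≤ 2 * d * x) :
    -(8 * d * b ^ 2 * h) ≤ nodePotential d b i h x y := by
  have hd' : (1 : ℝ) ≤ d := by exact_mod_cast hd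
  have hi' : (1 : ℝ) ≤ i := by exact_mod_cast hi
  have h1 := abs_nodePotential_sub_le d b i h 0 hx y
  have h2 : 0 ≤ nodePotential d b i 0 x y := by
    have hy2 : (y : ℝ) ≤ 2 * x := by
      have h3 : (y : ℝ) * d ≤ y * (d + i - 1) := by gcongr; linarith
      have h4 : (d : ℝ) * y ≤ d * (2 * x) := by linarith
      exact le_of_mul_le_mul_left h4 (by linarith)
    have h5 : 0 ≤ surplus d i x y := le_max_right _ _
    have h6 : 2 * x ≤ 4 * d * x := by nlinarith
    have h7 : 0 ≤ 4 * d * (2 * i * x) := by positivity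
    simp only [nodePotential, massPotential, value_zero_servers b hx]
    linarith
  have h3 := (abs_le.1 h1).1
  simp only [Nat.cast_zero, sub_zero, Nat.abs_cast] at h3
  linarith

end InfiniteServer

/-! ### Server counts of a configuration and their transport -/

namespace InfiniteServer

open WeightedTree

variable {V : Type u} {T : WeightedTree V}

/-- The servers that lie in the subtree hanging at `v`, for `v` different from the root. -/
def serversBelow (C : Config T.Node) (v : V) : Set ℕ := {i | v ∈ T.branch (C i)}

/-- The number of servers in the subtree hanging at `v`, for `v` different from the root. -/
def count (C : Config T.Node) (v : V) : ℕ := (serversBelow C v).ncard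

theorem moveCost_self {M : Type u} [MetricSpace M] (C : Config M) : moveCost C C = 0 := by
  simp [moveCost]

theorem moveCost_triangle {M : Type u} [MetricSpace M] (C C' C'' : Config M) :
    moveCost C C'' ≤ moveCost C C' + moveCost C' C'' := by
  rw [moveCost, moveCost, moveCost, ← ENNReal.tsum_add]
  exact ENNReal.tsum_le_tsum fun i => edist_triangle _ _ _

theorem serversBelow_subset (C : Config T.Node) (v : V) :
    serversBelow C v ⊆ {i | C i ≠ T.root} := by
  intro i hi h
  simp only [serversBelow, Set.mem_ofPred_eq] at hi
  rw [h, branch_root] at hi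
  simp at hi

theorem sum_count_eq_card {C : Config T.Node} {S : Finset V} {v : V}
    (hf : ∀ c ∈ S, (serversBelow C c).Finite) :
    ∃ F : Finset ℕ, F.card = ∑ c ∈ S with T.parent c = v, count C c ∧
      ∀ i, i ∈ F ↔ ∃ c ∈ S, T.parent c = v ∧ c ∈ T.branch (C i) := by
  set g : V → Finset ℕ := fun c => if h : (serversBelow C c).Finite then h.toFinset else ∅
  have hg : ∀ c ∈ S, (g c).card = count C c ∧ ∀ i, i ∈ g c ↔ c ∈ T.branch (C i) := by
    intro c hc
    have := hf c hc
    simp only [g, this, dif_pos]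
    refine ⟨(Set.ncard_eq_toFinset_card _ this).symm, fun i => ?_⟩
    simp [serversBelow]
  refine ⟨(S.filter (T.parent · = v)).biUnion g, ?_, fun i => ?_⟩
  · rw [Finset.card_biUnion]
    · exact Finset.sum_congr rfl fun c hc => (hg c (Finset.mem_filter.1 hc).1).1
    · intro a ha b hb hab
      obtain ⟨ha, hav⟩ := Finset.mem_filter.1 ha
      obtain ⟨hb, hbv⟩ := Finset.mem_filter.1 hb
      show Disjoint (g a) (g b)
      rw [Finset.disjoint_left]
      intro i hia hib
      exact hab (eq_of_mem_branch_of_parent_eq (((hg a ha).2 i).1 hia) (((hg b hb).2 i).1 hib)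
        (hav.trans hbv.symm))
  · simp only [Finset.mem_biUnion, Finset.mem_filter]
    constructor
    · rintro ⟨c, ⟨hc, hcv⟩, hi⟩
      exact ⟨c, hc, hcv, ((hg c hc).2 i).1 hi⟩
    · rintro ⟨c, hc, hcv, hi⟩
      exact ⟨c, ⟨hc, hcv⟩, ((hg c hc).2 i).2 hi⟩

/-- The subtrees of the children of `v` are disjoint, lie below `v` and do not contain `v`. -/
theorem sum_count_children_le {C : Config T.Node} {S : Finset V} {r v : V} (hv : v ≠ T.root)
    (hS : T.root ∉ S) (hf : ∀ v, v ≠ T.root → (serversBelow C v).Finite)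
    (hr : ∃ i, C i = r) :
    (∑ c ∈ S with T.parent c = v, count C c) + (if v = r then 1 else 0) ≤ count C v := by
  obtain ⟨F, hF, hFm⟩ := sum_count_eq_card (C := C) (S := S) (v := v)
    fun c hc => hf c (by rintro rfl; exact hS hc)
  have hFs : (F : Set ℕ) ⊆ serversBelow C v := by
    intro i hi
    obtain ⟨c, hc, hcv, hi⟩ := (hFm i).1 hi
    have := parent_mem_branch hi (by rw [hcv]; exact hv)
    rwa [hcv] at this
  rw [← hF, count]
  split_ifs with h
  · obtain ⟨i, hi⟩ := hr
    have hiF : i ∉ F := by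
      intro hiF
      obtain ⟨c, hc, hcv, hic⟩ := (hFm i).1 hiF
      exact parent_ne_of_mem_branch_self hic (by rw [hcv, hi, h])
    rw [← Finset.card_insert_of_notMem hiF, ← Set.ncard_coe_finset]
    refine Set.ncard_le_ncard ?_ (hf v hv)
    rw [Finset.coe_insert]
    refine Set.insert_subset ?_ hFs
    simp only [serversBelow, Set.mem_ofPred_eq]
    rw [hi, ← h]
    exact self_mem_branch hv
  · rw [add_zero, ← Set.ncard_coe_finset]
    exact Set.ncard_le_ncard hFs (hf v hv)

/-- If the subtrees of the children of `v` hold fewer servers than that of `v`, then some server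
is located at `v`. -/
theorem exists_server_of_sum_lt {C : Config T.Node} {S : Finset V} {v : V}
    (hfin : {i | C i ≠ T.root}.Finite) (hS : ∀ v, v ∉ S → count C v = 0)
    (h : ∑ c ∈ S with T.parent c = v, count C c < count C v) : ∃ i, C i = v := by
  have hf : ∀ v, (serversBelow C v).Finite := fun v => hfin.subset (serversBelow_subset C v)
  obtain ⟨F, hF, hFm⟩ := sum_count_eq_card (C := C) (S := S) (v := v) fun c _ => hf c
  by_contra! hne
  have hsub : serversBelow C v ⊆ F := by
    intro i hi
    obtain ⟨c, hc, hcv⟩ := exists_child_mem_branch hi (hne i)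
    refine (hFm i).2 ⟨c, ?_, hcv, hc⟩
    by_contra hcS
    have h0 := hS c hcS
    rw [count, Set.ncard_eq_zero (hf c)] at h0
    exact Set.eq_empty_iff_forall_notMem.1 h0 i hc
  have := Set.ncard_le_ncard hsub F.finite_toSet
  rw [Set.ncard_coe_finset, hF] at this
  exact absurd h (not_lt.2 this)

theorem exists_server_at_root {C : Config T.Node} (hfin : {i | C i ≠ T.root}.Finite) :
    ∃ i, C i = T.root := by
  by_contra! h
  have : {i | C i ≠ T.root} = Set.univ := Set.eq_univ_of_forall h
  rw [this] at hfin
  exact Set.infinite_univ hfin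

/-- Two configurations that differ by one server, which is at `v` in the first and at the parent
of `v` in the second. -/
theorem count_of_move {C C' : Config T.Node} {v : V} {i : ℕ} (hv : v ≠ T.root)
    (hfin : {i | C i ≠ T.root}.Finite) (hC : C i = v) (hC' : C' i = T.parent v)
    (hne : ∀ j ≠ i, C' j = C j) :
    count C v = count C' v + 1 ∧ ∀ a ≠ v, count C' a = count C a := by
  have hf : (serversBelow C v).Finite := hfin.subset (serversBelow_subset C v)
  constructor
  · have hi : i ∉ serversBelow C' v := by
      simp only [serversBelow, Set.mem_ofPred_eq]
      rw [hC']; exact notMem_branch_parent hv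
    have e : serversBelow C v = insert i (serversBelow C' v) := by
      ext j
      simp only [serversBelow, Set.mem_insert_iff, Set.mem_ofPred_eq]
      by_cases hj : j = i
      · subst hj; rw [hC]; simp [self_mem_branch hv]
      · rw [hne j hj]; simp [hj]
    rw [count, count, e, Set.ncard_insert_of_notMem hi
      (hf.subset (by rw [e]; exact Set.subset_insert _ _))]
  · intro a ha
    rw [count, count]
    congr 1
    ext j
    simp only [serversBelow, Set.mem_ofPred_eq]
    by_cases hj : j = i
    · subst hj; rw [hC, hC', branch_eq_insert hv]; simp [ha]
    · rw [hne j hj]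

theorem exists_move {C : Config T.Node} (hfin : {i | C i ≠ T.root}.Finite) (i : ℕ) (u : T.Node) :
    ∃ C' : Config T.Node, {j | C' j ≠ T.root}.Finite ∧ C' i = u ∧ (∀ j ≠ i, C' j = C j) ∧
      moveCost C C' = edist (C i) u := by
  refine ⟨Function.update C i u, ?_, Function.update_self _ _ _,
    fun j hj => Function.update_of_ne hj _ _, ?_⟩
  · refine (hfin.insert i).subset fun j hj => ?_
    by_cases h : j = i
    · exact Or.inl h
    · right
      simpa [Function.update_of_ne h] using hj
  · rw [moveCost, tsum_eq_single i]
    · simp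
    · intro j hj
      simp [Function.update_of_ne hj]

theorem edist_parent_le {u v : T.Node} (hv : v ≠ T.root) (hu : u = T.parent v) :
    edist u v ≤ ENNReal.ofReal (T.edgeWeight v) := by
  rw [edist_dist, hu]
  exact ENNReal.ofReal_le_ofReal (nodeDist_parent_le hv)

theorem edist_parent_le' {u v : T.Node} (hv : v ≠ T.root) (hu : u = T.parent v) :
    edist v u ≤ ENNReal.ofReal (T.edgeWeight v) := by
  rw [edist_comm]
  exact edist_parent_le hv hu

/-- A configuration can be changed to one with prescribed server counts `y`, at a cost given by
the changes of the counts: surplus servers move up, the deepest ones first, and then missing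
servers move down, the highest ones first. -/
theorem exists_transport {S : Finset V} (hS0 : T.root ∉ S)
    (hSp : ∀ v ∈ S, T.parent v ≠ T.root → T.parent v ∈ S) {y : V → ℕ} (hy0 : ∀ v, v ∉ S → y v = 0)
    (hy : ∀ v ∈ S, ∑ c ∈ S with T.parent c = v, y c ≤ y v) (C : Config T.Node)
    (hfin : {i | C i ≠ T.root}.Finite) (hC : ∀ v, v ∉ S → count C v = 0) :
    ∃ C' : Config T.Node, {i | C' i ≠ T.root}.Finite ∧ (∀ v, count C' v = y v) ∧
      moveCost C C' ≤ ENNReal.ofReal (∑ v ∈ S, T.edgeWeight v * |(y v : ℝ) - count C v|) := by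
  induction hn : ∑ v ∈ S, ((y v : ℤ) - count C v).natAbs using Nat.strong_induction_on
    generalizing C with
  | _ n ih =>
  have hne : ∀ v ∈ S, v ≠ T.root := by rintro v hv rfl; exact hS0 hv
  have hw : ∀ v ∈ S, 0 ≤ T.edgeWeight v := fun v hv => (edgeWeight_pos (hne v hv)).le
  -- An elementary move that decreases the difference at `v` by one.
  have step : ∀ v ∈ S, ∀ C₁ : Config T.Node, {i | C₁ i ≠ T.root}.Finite →
      moveCost C C₁ ≤ ENNReal.ofReal (T.edgeWeight v) → (∀ a ≠ v, count C₁ a = count C a) →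
      |(y v : ℤ) - count C v| = |(y v : ℤ) - count C₁ v| + 1 →
      ∃ C' : Config T.Node, {i | C' i ≠ T.root}.Finite ∧ (∀ v, count C' v = y v) ∧
        moveCost C C' ≤ ENNReal.ofReal (∑ v ∈ S, T.edgeWeight v * |(y v : ℝ) - count C v|) := by
    intro v hv C₁ hfin₁ hcost hother habs
    have hs : ∀ f : V → ℤ → ℝ, ∑ a ∈ S, f a ((y a : ℤ) - count C a) =
        f v ((y v : ℤ) - count C v) - f v ((y v : ℤ) - count C₁ v) +
          ∑ a ∈ S, f a ((y a : ℤ) - count C₁ a) := by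
      intro f
      rw [← Finset.add_sum_erase _ _ hv, ← Finset.add_sum_erase S
        (fun a => f a ((y a : ℤ) - count C₁ a)) hv]
      have : ∑ a ∈ S.erase v, f a ((y a : ℤ) - count C a) =
          ∑ a ∈ S.erase v, f a ((y a : ℤ) - count C₁ a) :=
        Finset.sum_congr rfl fun a ha => by rw [hother a (Finset.ne_of_mem_erase ha)]
      rw [this]; ring
    have habs' : |((y v : ℤ) - count C v : ℝ)| = |((y v : ℤ) - count C₁ v : ℝ)| + 1 := by
      exact_mod_cast habs
    have hlt : ∑ v ∈ S, ((y v : ℤ) - count C₁ v).natAbs < n := by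
      have h1 := hs fun _ z => (z.natAbs : ℝ)
      simp only [Nat.cast_natAbs] at h1
      rw [habs] at h1
      have h3 : ∑ v ∈ S, ((y v : ℤ) - count C v).natAbs =
          ∑ v ∈ S, ((y v : ℤ) - count C₁ v).natAbs + 1 := by
        rw [← Nat.cast_inj (R := ℝ)]
        push_cast [Nat.cast_natAbs] at h1 ⊢
        linarith
      rw [← hn]
      omega
    obtain ⟨C', h1, h2, h3⟩ := ih _ hlt C₁ hfin₁
      (fun a ha => by rw [hother a (by rintro rfl; exact ha hv)]; exact hC a ha) rfl
    refine ⟨C', h1, h2, (moveCost_triangle C C₁ C').trans ((add_le_add hcost h3).trans ?_)⟩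
    rw [← ENNReal.ofReal_add (hw v hv)
      (Finset.sum_nonneg fun a ha => mul_nonneg (hw a ha) (abs_nonneg _))]
    apply ENNReal.ofReal_le_ofReal
    have h4 := hs fun a z => T.edgeWeight a * |(z : ℝ)|
    push_cast at h4 habs'
    rw [h4, habs']
    linarith
  by_cases hA : ∃ v ∈ S, y v < count C v
  · obtain ⟨v₀, hv₀, hlt₀⟩ := hA
    obtain ⟨v, hv, hmax⟩ := (S.filter fun v => y v < count C v).exists_max_image T.level
      ⟨v₀, Finset.mem_filter.2 ⟨hv₀, hlt₀⟩⟩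
    obtain ⟨hv, hlt⟩ := Finset.mem_filter.1 hv
    have hch : ∑ c ∈ S with T.parent c = v, count C c < count C v := by
      refine lt_of_le_of_lt ((Finset.sum_le_sum fun c hc => ?_).trans (hy v hv)) hlt
      obtain ⟨hc, hcv⟩ := Finset.mem_filter.1 hc
      by_contra hcl
      have h1 := hmax c (Finset.mem_filter.2 ⟨hc, not_le.1 hcl⟩)
      have h2 := level_parent (hne c hc)
      rw [hcv] at h2
      omega
    obtain ⟨i, hi⟩ := exists_server_of_sum_lt hfin hC hch
    obtain ⟨C₁, hfin₁, h1, h2, hcost⟩ := exists_move hfin i (T.parent v)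
    obtain ⟨hm1, hm2⟩ := count_of_move (hne v hv) hfin hi h1 h2
    refine step v hv C₁ hfin₁ ?_ hm2 ?_
    · rw [hcost, hi]
      exact edist_parent_le' (hne v hv) rfl
    · rw [abs_of_nonpos, abs_of_nonpos] <;> omega
  push Not at hA
  by_cases hB : ∃ v ∈ S, count C v < y v
  · obtain ⟨v₀, hv₀, hlt₀⟩ := hB
    obtain ⟨v, hv, hmin⟩ := (S.filter fun v => count C v < y v).exists_min_image T.level
      ⟨v₀, Finset.mem_filter.2 ⟨hv₀, hlt₀⟩⟩
    obtain ⟨hv, hlt⟩ := Finset.mem_filter.1 hv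
    have hserver : ∃ i, C i = T.parent v := by
      by_cases hpr : T.parent v = T.root
      · rw [hpr]; exact exists_server_at_root hfin
      have hpS := hSp v hv hpr
      refine exists_server_of_sum_lt hfin hC ?_
      have hpc : y (T.parent v) ≤ count C (T.parent v) := by
        by_contra hpl
        have h1 := hmin _ (Finset.mem_filter.2 ⟨hpS, not_le.1 hpl⟩)
        have h2 := level_parent (hne v hv)
        omega
      refine lt_of_lt_of_le ?_ ((hy _ hpS).trans hpc)
      exact Finset.sum_lt_sum (fun c hc => hA c (Finset.mem_filter.1 hc).1)
        ⟨v, Finset.mem_filter.2 ⟨hv, rfl⟩, hlt⟩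
    obtain ⟨i, hi⟩ := hserver
    obtain ⟨C₁, hfin₁, h1, h2, hcost⟩ := exists_move hfin i v
    obtain ⟨hm1, hm2⟩ := count_of_move (hne v hv) hfin₁ h1 hi fun j hj => (h2 j hj).symm
    refine step v hv C₁ hfin₁ ?_ (fun a ha => (hm2 a ha).symm) ?_
    · rw [hcost, hi]
      exact edist_parent_le (hne v hv) rfl
    · rw [abs_of_nonneg, abs_of_nonneg] <;> omega
  · push Not at hB
    refine ⟨C, hfin, fun v => ?_, by simp [moveCost_self]⟩
    by_cases hv : v ∈ S
    · exact le_antisymm (hA v hv) (hB v hv)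
    · rw [hC v hv, hy0 v hv]

end InfiniteServer

/-! ### Server counts of an offline schedule -/

namespace InfiniteServer

open WeightedTree

variable {V : Type u} {T : WeightedTree V}

/-- The servers that cross the edge above `v` when the configuration changes. -/
def crossing (C C' : Config T.Node) (v : V) : Set ℕ :=
  {i | ¬ (v ∈ T.branch (C i) ↔ v ∈ T.branch (C' i))}

theorem sum_mul_encard_crossing_le_moveCost {F : Finset V} (hF : T.root ∉ F)
    (C C' : Config T.Node) :
    ∑ v ∈ F, ENNReal.ofReal (T.edgeWeight v) * ((crossing C C' v).encard : ℝ≥0∞) ≤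
      moveCost C C' := by
  have h1 : ∀ v, ((crossing C C' v).encard : ℝ≥0∞) =
      ∑' i, if ¬ (v ∈ T.branch (C i) ↔ v ∈ T.branch (C' i)) then 1 else 0 := by
    intro v
    rw [← ENNReal.tsum_set_one, tsum_subtype (crossing C C' v) fun _ => (1 : ℝ≥0∞)]
    refine tsum_congr fun i => ?_
    simp only [Set.indicator_apply, crossing, Set.mem_ofPred_eq]
  simp only [h1, ← ENNReal.tsum_mul_left]
  rw [← Summable.tsum_finsetSum fun _ _ => ENNReal.summable]
  refine ENNReal.tsum_le_tsum fun i => ?_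
  rw [edist_dist]
  refine le_trans (le_of_eq ?_)
    (ENNReal.ofReal_le_ofReal (sum_edgeWeight_symmDiff_le_nodeDist F hF (C i) (C' i)))
  rw [ENNReal.ofReal_sum_of_nonneg, Finset.sum_filter]
  · refine Finset.sum_congr rfl fun v _ => ?_
    split_ifs <;> simp
  · intro v hv
    exact (edgeWeight_pos (by rintro rfl; exact hF (Finset.mem_filter.1 hv).1)).le

theorem finite_crossing {C C' : Config T.Node} (h : moveCost C C' ≠ ⊤) {v : V} (hv : v ≠ T.root) :
    (crossing C C' v).Finite := by
  have h1 := sum_mul_encard_crossing_le_moveCost (F := {v}) (by simpa using hv.symm) C C'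
  rw [Finset.sum_singleton] at h1
  by_contra hinf
  have h2 : (crossing C C' v).encard = ⊤ := Set.encard_eq_top hinf
  rw [h2, ENat.toENNReal_top, ENNReal.mul_top
    (by simpa using edgeWeight_pos hv)] at h1
  exact h (top_le_iff.1 h1)

theorem serversBelow_subset_union (C C' : Config T.Node) (v : V) :
    serversBelow C' v ⊆ serversBelow C v ∪ crossing C C' v ∧
      serversBelow C v ⊆ serversBelow C' v ∪ crossing C C' v := by
  constructor <;> intro i hi <;>
    simp only [serversBelow, crossing, Set.mem_union, Set.mem_ofPred_eq] at hi ⊢ <;> tauto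

theorem finite_serversBelow_of_moveCost {C C' : Config T.Node} (h : moveCost C C' ≠ ⊤) {v : V}
    (hv : v ≠ T.root) (hf : (serversBelow C v).Finite) : (serversBelow C' v).Finite :=
  (hf.union (finite_crossing h hv)).subset (serversBelow_subset_union C C' v).1

/-- The cost of a move is at least the weighted change of the server counts. -/
theorem ofReal_sum_abs_count_sub_le_moveCost {F : Finset V} (hF : T.root ∉ F)
    {C C' : Config T.Node} (h : moveCost C C' ≠ ⊤)
    (hf : ∀ v, v ≠ T.root → (serversBelow C v).Finite) :
    ENNReal.ofReal (∑ v ∈ F, T.edgeWeight v * |(count C' v : ℝ) - count C v|) ≤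
      moveCost C C' := by
  have hne : ∀ v ∈ F, v ≠ T.root := by rintro v hv rfl; exact hF hv
  refine le_trans ?_ (sum_mul_encard_crossing_le_moveCost hF C C')
  rw [ENNReal.ofReal_sum_of_nonneg fun v hv =>
    mul_nonneg (edgeWeight_pos (hne v hv)).le (abs_nonneg _)]
  refine Finset.sum_le_sum fun v hv => ?_
  rw [ENNReal.ofReal_mul (edgeWeight_pos (hne v hv)).le]
  gcongr
  have hcr := finite_crossing h (hne v hv)
  have hfC := hf v (hne v hv)
  have hfC' := finite_serversBelow_of_moveCost h (hne v hv) hfC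
  have h1 : count C' v ≤ count C v + (crossing C C' v).ncard :=
    (Set.ncard_le_ncard (serversBelow_subset_union C C' v).1 (hfC.union hcr)).trans
      (Set.ncard_union_le _ _)
  have h2 : count C v ≤ count C' v + (crossing C C' v).ncard :=
    (Set.ncard_le_ncard (serversBelow_subset_union C C' v).2 (hfC'.union hcr)).trans
      (Set.ncard_union_le _ _)
  have h1' : (count C' v : ℝ) ≤ count C v + (crossing C C' v).ncard := by exact_mod_cast h1
  have h2' : (count C v : ℝ) ≤ count C' v + (crossing C C' v).ncard := by exact_mod_cast h2
  rw [← hcr.cast_ncard_eq, ENat.toENNReal_coe, ← ENNReal.ofReal_natCast]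
  apply ENNReal.ofReal_le_ofReal
  rw [abs_le]
  constructor <;> linarith

theorem one_le_count_of_server {C : Config T.Node} {v : V} {i : ℕ}
    (hf : (serversBelow C v).Finite) (h : v ∈ T.branch (C i)) : 1 ≤ count C v :=
  (Set.ncard_pos hf).2 ⟨i, h⟩

end InfiniteServer

/-! ### The online algorithm -/

namespace InfiniteServer

open WeightedTree

variable {V : Type u} {T : WeightedTree V}

/-- The memory of the online algorithm on a tree of depth `d`: the finite set of nodes met so far
(the branches of the past requests), the fractional masses of their subtrees, and the
configuration of the servers. -/
structure State (T : WeightedTree V) (d : ℕ) where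
  nodes : Finset V
  root_notMem : T.root ∉ nodes
  parent_mem : ∀ v ∈ nodes, T.parent v ≠ T.root → T.parent v ∈ nodes
  mass : V → ℝ
  mass_nonneg : ∀ v, 0 ≤ mass v
  mass_off : ∀ v ∉ nodes, mass v = 0
  childSum_mass_le : ∀ v ∈ nodes, childSum T.parent nodes mass v ≤ mass v
  servers : Config T.Node
  finite_servers : {i | servers i ≠ T.root}.Finite
  count_le : ∀ v, v ≠ T.root → count servers v * (d + T.level v - 1) ≤ 2 * d * mass v

namespace State

variable {d : ℕ}

/-- The initial state: all servers are at the root. -/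
def init (T : WeightedTree V) (d : ℕ) : State T d where
  nodes := ∅
  root_notMem := by simp
  parent_mem := by simp
  mass := 0
  mass_nonneg := by simp
  mass_off := by simp
  childSum_mass_le := by simp
  servers := fun _ => T.source
  finite_servers := Set.finite_empty.subset fun _ hi => hi rfl
  count_le := by
    intro v _
    have : serversBelow (T := T) (fun _ => T.source) v = ∅ := by
      ext i
      simp only [serversBelow, Set.mem_ofPred_eq, Set.mem_empty_iff_false, iff_false]
      change v ∉ T.branch T.root
      simp
    simp [count, this]

theorem level_pos {v : V} (hv : v ≠ T.root) : 1 ≤ T.level v := by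
  have := level_parent hv; omega

theorem count_root (C : Config T.Node) : count C T.root = 0 := by
  have : serversBelow C T.root = ∅ := by
    ext i
    exact iff_of_false (T.root_notMem_branch (C i)) (Set.notMem_empty i)
  simp [count, this]

theorem count_off (hd : 1 ≤ d) (s : State T d) (v : V) (hv : v ∉ s.nodes) :
    count s.servers v = 0 := by
  by_cases hr : v = T.root
  · rw [hr, count_root]
  · have h := s.count_le v hr
    rw [s.mass_off v hv, mul_zero] at h
    have h1 : (1 : ℝ) ≤ d := by exact_mod_cast hd
    have h2 : (1 : ℝ) ≤ T.level v := by exact_mod_cast level_pos hr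
    have h3 : (0 : ℝ) ≤ count s.servers v := Nat.cast_nonneg _
    have h4 : (count s.servers v : ℝ) = 0 := by nlinarith
    exact_mod_cast h4

/-- The total potential of a state, relative to a comparator with `h v` servers below `v`. -/
def potential (s : State T d) (F : Finset V) (h : V → ℕ) : ℝ :=
  ∑ v ∈ F, T.edgeWeight v *
    nodePotential d (6 * d + 4) (T.level v) (h v) (s.mass v) (count s.servers v)

/-- The properties of the transition from the state `s` to the state `s'` upon the request `r`:
the movement is paid for by the decrease of the potential, for every comparator that serves the
request. -/
structure IsStep (s : State T d) (r : V) (s' : State T d) (k : ℝ) : Prop where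
  serves : ∃ i, s'.servers i = r
  nodes_subset : s.nodes ⊆ s'.nodes
  nonneg : 0 ≤ k
  moveCost_le : moveCost s.servers s'.servers ≤ ENNReal.ofReal k
  potential_le : ∀ h : V → ℕ,
    (∀ v ∈ s'.nodes, ∑ c ∈ s'.nodes with T.parent c = v, h c + (if v = r then 1 else 0) ≤ h v) →
    (∀ v ∈ T.branch r, 1 ≤ h v) → ∀ F, s'.nodes ⊆ F →
    k + s'.potential F h ≤ s.potential F h

/-- The branch of `r` continues from each of its nodes other than `r` with exactly one child. -/
theorem childSum_branch_add {S : Finset V} {r v : V} (hS : T.branch r ⊆ S) (hv : v ≠ T.root) :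
    childSum T.parent S (fun c => if c ∈ T.branch r then 1 else 0) v + (if v = r then 1 else 0) =
      if v ∈ T.branch r then 1 else 0 := by
  by_cases hvr : v = r
  · subst hvr
    rw [if_pos rfl, if_pos (self_mem_branch hv), add_eq_right, childSum]
    refine Finset.sum_eq_zero fun c hc => if_neg fun hcb => ?_
    exact parent_ne_of_mem_branch_self hcb (Finset.mem_filter.1 hc).2
  · rw [if_neg hvr, add_zero]
    split_ifs with hb
    · obtain ⟨c, hc, hcv⟩ := exists_child_mem_branch hb (Ne.symm hvr)
      rw [childSum, Finset.sum_eq_single c]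
      · rw [if_pos hc]
      · intro c' hc' hne
        refine if_neg fun hcb => hne ?_
        exact eq_of_mem_branch_of_parent_eq hcb hc ((Finset.mem_filter.1 hc').2.trans hcv.symm)
      · intro hcm
        exact absurd (Finset.mem_filter.2 ⟨hS hc, hcv⟩) hcm
    · refine Finset.sum_eq_zero fun c hc => if_neg fun hcb => hb ?_
      have hcv := (Finset.mem_filter.1 hc).2
      rw [← hcv]
      exact parent_mem_branch hcb (by rw [hcv]; exact hv)

theorem childSum_mass_le_of_subset (s : State T d) {S : Finset V} (hS : s.nodes ⊆ S) {v : V}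
    (hv : v ≠ T.root) : childSum T.parent S s.mass v ≤ s.mass v := by
  have h1 : childSum T.parent S s.mass v = childSum T.parent s.nodes s.mass v := by
    symm
    refine Finset.sum_subset (Finset.filter_subset_filter _ hS) fun c hc hc' => s.mass_off c ?_
    intro hcs
    exact hc' (Finset.mem_filter.2 ⟨hcs, (Finset.mem_filter.1 hc).2⟩)
  rw [h1]
  by_cases hvs : v ∈ s.nodes
  · exact s.childSum_mass_le v hvs
  · rw [s.mass_off v hvs]
    refine le_of_eq (Finset.sum_eq_zero fun c hc => ?_)
    obtain ⟨hc, hcv⟩ := Finset.mem_filter.1 hc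
    exact absurd (hcv ▸ s.parent_mem c hc (by rw [hcv]; exact hv)) hvs

/-- Rounding preserves the constraint at `v`, including the demand at a requested node. -/
theorem sum_roundServers_add_le (hd : 1 ≤ d) (hl : ∀ v, T.level v ≤ d) {S : Finset V}
    (hS : T.root ∉ S) {r v : V} {x : V → ℝ} (y : V → ℕ) (hx : ∀ v ∈ S, 0 ≤ x v) (hv : v ∈ S)
    (h : childSum T.parent S x v + (if v = r then 1 else 0) ≤ x v) :
    ∑ c ∈ S with T.parent c = v, roundServers d (T.level c) (x c) (y c) +
      (if v = r then 1 else 0) ≤ roundServers d (T.level v) (x v) (y v) := by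
  have hne : ∀ v ∈ S, v ≠ T.root := by rintro v hv rfl; exact hS hv
  have hlv : (T.level v : ℝ) ≤ d := by exact_mod_cast hl v
  have hl1 : (1 : ℝ) ≤ T.level v := by exact_mod_cast level_pos (hne v hv)
  have h1 : (∑ c ∈ S with T.parent c = v, (roundServers d (T.level c) (x c) (y c) : ℝ)) *
      (d + T.level v) ≤ 2 * d * childSum T.parent S x v := by
    rw [childSum, Finset.sum_mul, Finset.mul_sum]
    refine Finset.sum_le_sum fun c hc => ?_
    obtain ⟨hc, hcv⟩ := Finset.mem_filter.1 hc
    have h2 := (roundServers_bounds hd (level_pos (hne c hc)) (hx c hc) (y c)).1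
    have h3 := level_parent (hne c hc)
    rw [hcv] at h3
    rw [h3] at h2 ⊢
    push_cast at h2
    linarith
  have h2 := (roundServers_bounds hd (level_pos (hne v hv)) (hx v hv) (y v)).2
  set A := ∑ c ∈ S with T.parent c = v, roundServers d (T.level c) (x c) (y c) with hA
  set q : ℕ := if v = r then 1 else 0 with hq
  have hq' : (if v = r then 1 else 0 : ℝ) = q := by rw [hq]; split_ifs <;> simp
  have hA' : ∑ c ∈ S with T.parent c = v, (roundServers d (T.level c) (x c) (y c) : ℝ) = A := by
    rw [hA]; push_cast; rfl
  rw [hq'] at h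
  rw [hA'] at h1
  have hq0 : (0 : ℝ) ≤ q := Nat.cast_nonneg _
  have hd0 : (0 : ℝ) ≤ d := Nat.cast_nonneg _
  have h3 : 2 * d * (childSum T.parent S x v + q) ≤ 2 * d * x v := by gcongr
  have h4 : (q : ℝ) * (d + T.level v) ≤ q * (2 * d) := by gcongr; linarith
  have h5 : ((A + q : ℕ) : ℝ) * (d + T.level v) <
      ((roundServers d (T.level v) (x v) (y v) + 1 : ℕ) : ℝ) * (d + T.level v) := by
    push_cast; linarith
  have h6 := lt_of_mul_lt_mul_right h5 (by linarith)
  have h7 : A + q < roundServers d (T.level v) (x v) (y v) + 1 := by exact_mod_cast h6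
  omega

theorem exists_isStep (hd : 1 ≤ d) (hl : ∀ v, T.level v ≤ d) (s : State T d) (r : V) :
    ∃ (s' : State T d) (k : ℝ), IsStep s r s' k := by
  by_cases hr : r = T.root
  · subst hr
    exact ⟨s, 0, exists_server_at_root s.finite_servers, subset_rfl, le_rfl,
      by simp [moveCost_self], fun h _ _ F _ => by simp⟩
  set S : Finset V := s.nodes ∪ T.branch r with hSdef
  set p : V → ℝ := fun v => if v ∈ T.branch r then 1 else 0 with hp
  set q : V → ℝ := fun v => if v = r then 1 else 0 with hq
  have hS : T.root ∉ S := by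
    simp [hSdef, s.root_notMem, root_notMem_branch]
  have hne : ∀ v ∈ S, v ≠ T.root := by rintro v hv rfl; exact hS hv
  have hw : ∀ v ∈ S, 0 ≤ T.edgeWeight v := fun v hv => (edgeWeight_pos (hne v hv)).le
  have hp01 : ∀ v, p v = 0 ∨ p v = 1 := by
    intro v; simp only [hp]; split_ifs <;> simp
  have hq01 : ∀ v, q v = 0 ∨ q v = 1 ∧ p v = 1 := by
    intro v
    simp only [hq, hp]
    by_cases h : v = r
    · right; rw [h, if_pos rfl, if_pos (self_mem_branch hr)]; exact ⟨rfl, rfl⟩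
    · left; rw [if_neg h]
  obtain ⟨x', hadm, hmono, hpot⟩ := exists_fractional_step (par := T.parent) (S := S)
    (w := T.edgeWeight) (x := s.mass) (p := p) (q := q) (l := T.level) (b := 6 * d + 4) hw
    (fun v _ c hc hcv => by rw [← hcv]; exact level_parent (hne c hc))
    (fun v _ => by have := hl v; omega) s.mass_nonneg hp01 hq01
    (fun v hv => s.childSum_mass_le_of_subset Finset.subset_union_left (hne v hv))
    (fun v hv => childSum_branch_add Finset.subset_union_right (hne v hv))
  set y : V → ℕ := fun v =>
    if v ∈ S then roundServers d (T.level v) (x' v) (count s.servers v) else 0 with hy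
  have hyS : ∀ v ∈ S, y v = roundServers d (T.level v) (x' v) (count s.servers v) :=
    fun v hv => if_pos hv
  have hysum : ∀ v ∈ S, ∑ c ∈ S with T.parent c = v, y c + (if v = r then 1 else 0) ≤ y v := by
    intro v hv
    have := sum_roundServers_add_le hd hl hS (count s.servers) hadm.nonneg hv (hadm.sum_le v hv)
    rw [hyS v hv]
    rwa [Finset.sum_congr rfl fun c hc => hyS c (Finset.mem_filter.1 hc).1]
  have hSp : ∀ v ∈ S, T.parent v ≠ T.root → T.parent v ∈ S := by
    intro v hv hvp
    rcases Finset.mem_union.1 hv with h | h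
    · exact Finset.mem_union_left _ (s.parent_mem v h hvp)
    · exact Finset.mem_union_right _ (parent_mem_branch h hvp)
  have hcount0 : ∀ v, v ∉ S → count s.servers v = 0 := fun v hv =>
    s.count_off hd v fun h => hv (Finset.mem_union_left _ h)
  obtain ⟨C', hfin', hC', hcost⟩ := exists_transport hS hSp (y := y) (fun v hv => if_neg hv)
    (fun v hv => (Nat.le_add_right _ _).trans (hysum v hv)) s.servers s.finite_servers hcount0
  have hx'0 : ∀ v, 0 ≤ x' v := fun v => by
    by_cases hv : v ∈ S
    · exact hadm.nonneg v hv
    · rw [hadm.zero_off v hv]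
  refine ⟨⟨S, hS, hSp, x', hx'0, hadm.zero_off, fun v hv => ?_, C', hfin', fun v hv => ?_⟩,
    ∑ v ∈ S, T.edgeWeight v * |(y v : ℝ) - count s.servers v|, ?_, Finset.subset_union_left,
    Finset.sum_nonneg fun v hv => mul_nonneg (hw v hv) (abs_nonneg _), hcost,
    fun h hh hh1 F hF => ?_⟩
  · have h1 := hadm.sum_le v hv
    have h2 : 0 ≤ q v := by rcases hq01 v with h | ⟨h, -⟩ <;> rw [h]; norm_num
    linarith
  · rw [hC']
    by_cases hvS : v ∈ S
    · rw [hyS v hvS]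
      exact (roundServers_bounds hd (level_pos hv) (hx'0 v) _).1
    · simp [hy, hvS, hadm.zero_off v hvS]
  · have hrS : r ∈ S := Finset.mem_union_right _ (self_mem_branch hr)
    refine exists_server_of_sum_lt (S := S) hfin'
      (fun v hv => by rw [hC']; exact if_neg hv) ?_
    have := hysum r hrS
    rw [if_pos rfl] at this
    simp only [hC']
    omega
  · -- Outside `S` neither state has mass or servers, so the sums over `F` reduce to `S`.
    have hred : ∑ v ∈ F, T.edgeWeight v *
          (nodePotential d (6 * d + 4) (T.level v) (h v) (x' v) (y v) -
          nodePotential d (6 * d + 4) (T.level v) (h v) (s.mass v) (count s.servers v)) =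
        ∑ v ∈ S, T.edgeWeight v *
          (nodePotential d (6 * d + 4) (T.level v) (h v) (x' v) (y v) -
          nodePotential d (6 * d + 4) (T.level v) (h v) (s.mass v) (count s.servers v)) := by
      symm
      refine Finset.sum_subset hF fun v _ hv => ?_
      have h1 : s.mass v = 0 := s.mass_off v fun h => hv (Finset.mem_union_left _ h)
      have h2 : y v = 0 := if_neg hv
      rw [hcount0 v hv, hadm.zero_off v hv, h1, h2, sub_self, mul_zero]
    have hfrac := hpot h (fun v hv => by
        have h1 : ((∑ c ∈ S with T.parent c = v, h c + (if v = r then 1 else 0) : ℕ) : ℝ) ≤ h v :=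
          by exact_mod_cast hh v hv
        push_cast at h1
        exact h1)
      (fun v hv hpv => hh1 v (by
        by_contra hvb
        simp [hp, hvb] at hpv))
    have hpt : ∀ v ∈ S, T.edgeWeight v * |(y v : ℝ) - count s.servers v| + T.edgeWeight v *
          (nodePotential d (6 * d + 4) (T.level v) (h v) (x' v) (y v) -
          nodePotential d (6 * d + 4) (T.level v) (h v) (s.mass v) (count s.servers v)) ≤
        4 * d * (T.edgeWeight v * (p v * (x' v - s.mass v)) + T.edgeWeight v *
          (massPotential (6 * d + 4) (T.level v) (h v) (x' v) -
            massPotential (6 * d + 4) (T.level v) (h v) (s.mass v))) := by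
      intro v hv
      have h1 := abs_add_nodePotential_sub_le hd (level_pos (hne v hv)) (6 * d + 4) (h v)
        (x := s.mass v) (hx'0 v) (count s.servers v)
      have h2 : max (x' v - s.mass v) 0 = p v * (x' v - s.mass v) := by
        rcases hp01 v with h0 | h0
        · rw [h0, zero_mul]
          exact max_eq_right (sub_nonpos.2 ((hmono v hv).1 h0))
        · rw [h0, one_mul]
          exact max_eq_left (sub_nonneg.2 ((hmono v hv).2 h0))
      rw [h2, ← hyS v hv] at h1
      have h3 := mul_le_mul_of_nonneg_left h1 (hw v hv)
      linarith
    have hsum := Finset.sum_le_sum hpt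
    rw [← Finset.mul_sum, Finset.sum_add_distrib, Finset.sum_add_distrib, ← hred] at hsum
    have hd0 : (0 : ℝ) ≤ 4 * d := by positivity
    have hneg := mul_nonpos_of_nonneg_of_nonpos hd0 hfrac
    simp only [potential, hC']
    simp only [mul_sub, Finset.sum_sub_distrib] at hsum hneg
    linarith

/-- The transition of the online algorithm upon the request `r`. -/
def step (hd : 1 ≤ d) (hl : ∀ v, T.level v ≤ d) (s : State T d) (r : T.Node) : State T d :=
  (exists_isStep hd hl s r).choose

/-- The bound for the cost of a transition. -/
def stepCost (hd : 1 ≤ d) (hl : ∀ v, T.level v ≤ d) (s : State T d) (r : T.Node) : ℝ :=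
  (exists_isStep hd hl s r).choose_spec.choose

theorem isStep_step (hd : 1 ≤ d) (hl : ∀ v, T.level v ≤ d) (s : State T d) (r : T.Node) :
    IsStep s r (step hd hl s r) (stepCost hd hl s r) :=
  (exists_isStep hd hl s r).choose_spec.choose_spec

/-- The state after the requests `σ`. -/
def run (hd : 1 ≤ d) (hl : ∀ v, T.level v ≤ d) (σ : List T.Node) : State T d :=
  σ.foldl (step hd hl) (init T d)

theorem run_append_singleton (hd : 1 ≤ d) (hl : ∀ v, T.level v ≤ d) (σ : List T.Node)
    (r : T.Node) : run hd hl (σ ++ [r]) = step hd hl (run hd hl σ) r := by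
  simp [run, List.foldl_append]

theorem nodes_run_subset (hd : 1 ≤ d) (hl : ∀ v, T.level v ≤ d) (σ τ : List T.Node) :
    (run hd hl σ).nodes ⊆ (run hd hl (σ ++ τ)).nodes := by
  induction τ using List.reverseRecOn with
  | nil => simp
  | append_singleton τ r ih =>
    rw [← List.append_assoc, run_append_singleton]
    exact ih.trans (isStep_step hd hl _ r).nodes_subset

end State

open State

/-- The online algorithm for trees of depth at most `d`. -/
def treeAlgorithm {d : ℕ} (hd : 1 ≤ d) (hl : ∀ v, T.level v ≤ d) :
    OnlineAlgorithm T.Node T.source where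
  config σ := (run hd hl σ).servers
  config_nil i := rfl
  serves σ r := by
    rw [run_append_singleton]
    exact (isStep_step hd hl _ r).serves

end InfiniteServer

/-! ### Competitiveness -/

namespace InfiniteServer

open WeightedTree State

variable {V : Type u} {T : WeightedTree V} {d : ℕ}

theorem edgeWeight_nonneg_of_mem (s : State T d) {v : V} (hv : v ∈ s.nodes) :
    0 ≤ T.edgeWeight v :=
  (edgeWeight_pos (by rintro rfl; exact s.root_notMem hv)).le

theorem potential_init (F : Finset V) (h : V → ℕ) : (init T d).potential F h = 0 := by
  refine Finset.sum_eq_zero fun v _ => ?_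
  have hm : (init T d).mass v = 0 := rfl
  have hc : count (init T d).servers v = 0 := by
    have : serversBelow (init T d).servers v = ∅ := by
      ext i
      simp only [serversBelow, Set.mem_ofPred_eq, Set.mem_empty_iff_false, iff_false]
      change v ∉ T.branch T.root
      simp
    simp [count, this]
  rw [hm, hc, nodePotential_zero, mul_zero]

theorem potential_sub_le (s : State T d) {F : Finset V} (hF : ∀ v ∈ F, 0 ≤ T.edgeWeight v)
    (h h' : V → ℕ) :
    s.potential F h' ≤ s.potential F h +
      8 * d * (6 * d + 4) ^ 2 * ∑ v ∈ F, T.edgeWeight v * |(h' v : ℝ) - h v| := by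
  rw [potential, potential, Finset.mul_sum, ← Finset.sum_add_distrib]
  refine Finset.sum_le_sum fun v hv => ?_
  have h1 := abs_nodePotential_sub_le d (6 * d + 4) (T.level v) (h' v) (h v) (s.mass_nonneg v)
    (count s.servers v)
  push_cast at h1
  have h2 := mul_le_mul_of_nonneg_left ((le_abs_self _).trans h1) (hF v hv)
  linarith

theorem neg_le_potential (hd : 1 ≤ d) (s : State T d) {F : Finset V} (hF : T.root ∉ F)
    (h : V → ℕ) :
    -(8 * d * (6 * d + 4) ^ 2 * ∑ v ∈ F, T.edgeWeight v * h v) ≤ s.potential F h := by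
  rw [potential, Finset.mul_sum, ← Finset.sum_neg_distrib]
  refine Finset.sum_le_sum fun v hv => ?_
  have hne : v ≠ T.root := by rintro rfl; exact hF hv
  have h1 := neg_le_nodePotential hd (level_pos hne) (6 * d + 4) (h v) (s.mass_nonneg v)
    (s.count_le v hne)
  push_cast at h1
  have h2 := mul_le_mul_of_nonneg_left h1 (edgeWeight_pos hne).le
  linarith

/-- A schedule of finite cost has finitely many servers below each node other than the root. -/
theorem finite_serversBelow_schedule {m : ℕ} {c : ℕ → Config T.Node} (h0 : ∀ i, c 0 i = T.source)
    (hc : ∀ j < m, moveCost (c j) (c (j + 1)) ≠ ⊤) {j : ℕ} (hj : j ≤ m) {v : V}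
    (hv : v ≠ T.root) : (serversBelow (c j) v).Finite := by
  induction j with
  | zero =>
    refine Set.finite_empty.subset fun i hi => ?_
    simp only [serversBelow, Set.mem_ofPred_eq] at hi
    rw [h0 i] at hi
    change v ∈ T.branch T.root at hi
    simp at hi
  | succ j ih => exact finite_serversBelow_of_moveCost (hc j (by omega)) hv (ih (by omega))

/-- The potential argument, over all requests: the cost of the algorithm is bounded by the
weighted changes of the server counts of any schedule. -/
theorem sum_stepCost_le (hd : 1 ≤ d) (hl : ∀ v, T.level v ≤ d) (σ : List T.Node)
    {c : ℕ → Config T.Node} (hc : IsSchedule T.source σ c)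
    (hcost : ∀ j < σ.length, moveCost (c j) (c (j + 1)) ≠ ⊤) :
    ∃ k : ℕ → ℝ, (∀ j < σ.length, 0 ≤ k j ∧
        moveCost ((run hd hl (σ.take j)).servers) ((run hd hl (σ.take (j + 1))).servers) ≤
          ENNReal.ofReal (k j)) ∧
      ∑ j ∈ Finset.range σ.length, k j ≤ 16 * d * (6 * d + 4) ^ 2 *
        ∑ j ∈ Finset.range σ.length, ∑ v ∈ (run hd hl σ).nodes,
          T.edgeWeight v * |(count (c (j + 1)) v : ℝ) - count (c j) v| := by
  set F := (run hd hl σ).nodes with hF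
  have hF0 : T.root ∉ F := (run hd hl σ).root_notMem
  have hFw : ∀ v ∈ F, 0 ≤ T.edgeWeight v := fun v hv => edgeWeight_nonneg_of_mem _ hv
  have hfin : ∀ j ≤ σ.length, ∀ v, v ≠ T.root → (serversBelow (c j) v).Finite :=
    fun j hj v hv => finite_serversBelow_schedule hc.1 hcost hj hv
  set k : ℕ → ℝ := fun j => if h : j < σ.length then
    stepCost hd hl (run hd hl (σ.take j)) σ[j] else 0 with hk
  have hstep : ∀ j < σ.length, ∃ r, IsStep (run hd hl (σ.take j)) r
      (run hd hl (σ.take (j + 1))) (k j) ∧ ∃ i, c (j + 1) i = r := by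
    intro j hj
    refine ⟨σ[j], ?_, hc.2 j hj⟩
    have e : σ.take (j + 1) = σ.take j ++ [σ[j]] := List.take_succ_eq_append_getElem hj
    rw [e, run_append_singleton]
    simp only [hk, hj, dif_pos]
    exact isStep_step hd hl _ _
  set μ : ℕ → ℝ := fun j =>
    ∑ v ∈ F, T.edgeWeight v * |(count (c (j + 1)) v : ℝ) - count (c j) v| with hμ
  have hsub : ∀ j, (run hd hl (σ.take j)).nodes ⊆ F := by
    intro j
    have := nodes_run_subset hd hl (σ.take j) (σ.drop j)
    rwa [List.take_append_drop] at this
  have hmain : ∀ j ≤ σ.length, ∑ i ∈ Finset.range j, k i +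
      (run hd hl (σ.take j)).potential F (count (c j)) ≤
        8 * d * (6 * d + 4) ^ 2 * ∑ i ∈ Finset.range j, μ i := by
    intro j hj
    induction j with
    | zero =>
      have : (run hd hl (σ.take 0)).potential F (count (c 0)) = 0 := by
        rw [List.take_zero]; exact potential_init F _
      rw [this]; simp
    | succ j ih =>
      have hj' : j < σ.length := hj
      obtain ⟨r, hst, i, hi⟩ := hstep j hj'
      have h1 := hst.potential_le (count (c (j + 1)))
        (fun v hv => sum_count_children_le
          (by rintro rfl; exact (run hd hl (σ.take (j + 1))).root_notMem hv)
          (run hd hl (σ.take (j + 1))).root_notMem (hfin _ hj) ⟨i, hi⟩)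
        (fun v hv => one_le_count_of_server (hfin _ hj v (T.ne_root_of_mem_branch hv))
          (i := i) (by rw [hi]; exact hv)) F (hsub _)
      have h2 := potential_sub_le (run hd hl (σ.take j)) hFw (count (c j)) (count (c (j + 1)))
      have h3 := ih hj'.le
      rw [Finset.sum_range_succ, Finset.sum_range_succ, mul_add]
      have h4 : ∑ v ∈ F, T.edgeWeight v * |(count (c (j + 1)) v : ℝ) - count (c j) v| = μ j := rfl
      rw [h4] at h2
      linarith
  have hcount : ∀ j ≤ σ.length, ∑ v ∈ F, T.edgeWeight v * (count (c j) v : ℝ) ≤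
      ∑ i ∈ Finset.range j, μ i := by
    intro j hj
    induction j with
    | zero =>
      refine le_of_eq (Finset.sum_eq_zero fun v hv => ?_)
      have : serversBelow (c 0) v = ∅ := by
        refine Set.eq_empty_iff_forall_notMem.2 fun i hi => ?_
        simp only [serversBelow, Set.mem_ofPred_eq] at hi
        rw [hc.1 i] at hi
        change v ∈ T.branch T.root at hi
        simp at hi
      simp [count, this]
    | succ j ih =>
      rw [Finset.sum_range_succ]
      refine le_trans ?_ (add_le_add_left (ih (by omega)) _)
      rw [hμ, ← Finset.sum_add_distrib]
      refine Finset.sum_le_sum fun v hv => ?_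
      rw [← mul_add]
      refine mul_le_mul_of_nonneg_left ?_ (hFw v hv)
      linarith [le_abs_self ((count (c (j + 1)) v : ℝ) - count (c j) v)]
  refine ⟨k, fun j hj => ?_, ?_⟩
  · obtain ⟨r, hst, -⟩ := hstep j hj
    exact ⟨hst.nonneg, hst.moveCost_le⟩
  · have h1 := hmain σ.length le_rfl
    have h2 := neg_le_potential hd (run hd hl (σ.take σ.length)) hF0 (count (c σ.length))
    have h3 := mul_le_mul_of_nonneg_left (hcount σ.length le_rfl)
      (show (0 : ℝ) ≤ 8 * d * (6 * d + 4) ^ 2 by positivity)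
    linarith

theorem cost_treeAlgorithm_le (hd : 1 ≤ d) (hl : ∀ v, T.level v ≤ d) (σ : List T.Node) :
    (treeAlgorithm hd hl).cost σ ≤ (16 * d * (6 * d + 4) ^ 2 : ℝ≥0) * opt T.source σ := by
  have hρ : ((16 * d * (6 * d + 4) ^ 2 : ℝ≥0) : ℝ≥0∞) ≠ 0 := by
    have : (d : ℝ≥0) ≠ 0 := by exact_mod_cast (by omega : d ≠ 0)
    simp only [ne_eq, ENNReal.coe_eq_zero]
    positivity
  rw [opt, ENNReal.mul_iInf_of_ne hρ ENNReal.coe_ne_top]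
  refine le_iInf fun c => ?_
  rw [ENNReal.mul_iInf_of_ne hρ ENNReal.coe_ne_top]
  refine le_iInf fun hc => ?_
  by_cases htop : scheduleCost σ.length c = ⊤
  · rw [htop, ENNReal.mul_top hρ]
    exact le_top
  have hcost : ∀ j < σ.length, moveCost (c j) (c (j + 1)) ≠ ⊤ := by
    intro j hj h
    refine htop (top_le_iff.1 ?_)
    rw [← h]
    exact Finset.single_le_sum (f := fun j => moveCost (c j) (c (j + 1))) (fun _ _ => zero_le)
      (Finset.mem_range.2 hj)
  obtain ⟨k, hk, hsum⟩ := sum_stepCost_le hd hl σ hc hcost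
  set μ : ℕ → ℝ := fun j => ∑ v ∈ (run hd hl σ).nodes,
    T.edgeWeight v * |(count (c (j + 1)) v : ℝ) - count (c j) v| with hμ
  have hμ0 : ∀ j, 0 ≤ μ j := fun j => Finset.sum_nonneg fun v hv =>
    mul_nonneg (edgeWeight_nonneg_of_mem _ hv) (abs_nonneg _)
  calc (treeAlgorithm hd hl).cost σ
      ≤ ∑ j ∈ Finset.range σ.length, ENNReal.ofReal (k j) :=
        Finset.sum_le_sum fun j hj => (hk j (Finset.mem_range.1 hj)).2
    _ = ENNReal.ofReal (∑ j ∈ Finset.range σ.length, k j) :=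
        (ENNReal.ofReal_sum_of_nonneg fun j hj => (hk j (Finset.mem_range.1 hj)).1).symm
    _ ≤ ENNReal.ofReal (16 * d * (6 * d + 4) ^ 2 * ∑ j ∈ Finset.range σ.length, μ j) :=
        ENNReal.ofReal_le_ofReal hsum
    _ = (16 * d * (6 * d + 4) ^ 2 : ℝ≥0) * ∑ j ∈ Finset.range σ.length, ENNReal.ofReal (μ j) := by
        rw [ENNReal.ofReal_mul (by positivity), ENNReal.ofReal_sum_of_nonneg fun j _ => hμ0 j]
        congr 1
        rw [← ENNReal.ofReal_coe_nnreal]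
        push_cast
        rfl
    _ ≤ _ := by
        gcongr
        refine Finset.sum_le_sum fun j hj => ?_
        have hj' := Finset.mem_range.1 hj
        exact ofReal_sum_abs_count_sub_le_moveCost (run hd hl σ).root_notMem (hcost j hj')
          fun v hv => finite_serversBelow_schedule hc.1 hcost hj'.le hv

end InfiniteServer

namespace WeightedTree

theorem level_le_of_depth_eq {V : Type u} {T : WeightedTree V} {d : ℕ} (h : T.depth = d) (v : V) :
    T.level v ≤ d := by
  have h1 : (T.level v : ℕ∞) ≤ T.depth :=
    le_iSup (fun v => ((T.path T.root v).length : ℕ∞)) v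
  rw [h] at h1
  exact_mod_cast h1

end WeightedTree

theorem sq_le_two_mul_two_pow (d : ℕ) : d ^ 2 ≤ 2 * 2 ^ d := by
  rcases le_or_gt d 2 with h | h
  · interval_cases d <;> norm_num
  · induction d, h using Nat.le_induction with
    | base => norm_num
    | succ n hn ih => rw [pow_succ 2 n]; nlinarith

end

theorem mainTheorem11 :
    ∃ C : ℝ≥0, ∀ d : ℕ, 1 ≤ d → ∀ (V : Type u) (T : WeightedTree V), T.depth = d →
      InfiniteServer.competitiveRatio T.Node T.source ≤ C * (2 ^ d * d) := by
  refine ⟨3200, fun d hd V T hT => ?_⟩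
  have hl := WeightedTree.level_le_of_depth_eq hT
  -- The algorithm is in fact `O(d ^ 3)`-competitive.
  have hnat : 16 * d * (6 * d + 4) ^ 2 ≤ 3200 * (2 ^ d * d) := by
    have h1 : (6 * d + 4) ^ 2 ≤ (10 * d) ^ 2 := Nat.pow_le_pow_left (by omega) 2
    have h2 := sq_le_two_mul_two_pow d
    calc 16 * d * (6 * d + 4) ^ 2 ≤ 16 * d * (10 * d) ^ 2 := Nat.mul_le_mul_left _ h1
      _ = 1600 * d * d ^ 2 := by ring
      _ ≤ 1600 * d * (2 * 2 ^ d) := Nat.mul_le_mul_left _ h2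
      _ = _ := by ring
  have hone : 1 ≤ 16 * d * (6 * d + 4) ^ 2 := Nat.one_le_iff_ne_zero.2 (by positivity)
  have hcomp : (InfiniteServer.treeAlgorithm hd hl).IsCompetitive
      (16 * d * (6 * d + 4) ^ 2 : ℝ≥0) := by
    refine ⟨by exact_mod_cast hone, 0, fun σ => ?_⟩
    simpa using InfiniteServer.cost_treeAlgorithm_le hd hl σ
  refine (iInf_le_of_le (InfiniteServer.treeAlgorithm hd hl) (iInf₂_le _ hcomp)).trans ?_
  exact_mod_cast hnat
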